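/- **Setting.** A player with a finite action set $\mathcal A$, $|\mathcal A|=K\ge 1$, repeatedly plays a game with opponents whose joint actions lie in a set $\mathcal A^{-}$, under contexts from a finite set $\mathcal Z$. Let $\mathcal D=\mathcal A\times\mathcal A^{-}\times\mathcal Z$, let $k:\mathcal D\times\mathcal D\to[-1,1]$ be a (measurable) positive semidefinite kernel, and let the unknown reward function $r:\mathcal D\to[0,1]$ lie in the reproducing kernel Hilbert space of $k$ with norm $\|r\|_k\le B$. In round $t$ the context $z_t$ is revealed; the player draws $a_t\in\mathcal A$ while, simultaneously, the opponents choose $a_t^{-}$ (contexts and opponents' actions may depend arbitrarily on the past and on additional randomness; $a_t^-$ may depend on $z_t$ but, given the past and $z_t$, not on $a_t$). The player then observes $a_t^{-}$ and $\tilde r_t=r(a_t,a_t^{-},z_t)+\epsilon_t$, where $\epsilon_t$ is independent of all previous rounds and of $(a_t,a_t^-,z_t)$, and is $\sigma$-sub-Gaussian: $\mathbb E[e^{\alpha\epsilon_t}]\le e^{\alpha^2\sigma^2/2}$ for all $\alpha\in\mathbb R$. With $x_j=(a_j,a_j^{-},z_j)$, $\mathbf K_n=[k(x_i,x_j)]_{i,j\le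 n}$, $\mathbf k_n(x)=[k(x_j,x)]_{j\le n}$, $\mathbf y_n=[\tilde r_j]_{j\le n}$ and $\lambda\geq 1$, put $$\mu_n(x)=\mathbf k_n(x)^{T}(\mathbf K_n+\lambda \mathbf I_n)^{-1}\mathbf y_n,\qquad \sigma_n^2(x)=k(x,x)-\mathbf k_n(x)^{T}(\mathbf K_n+\lambda \mathbf I_n)^{-1}\mathbf k_n(x),$$ $$\gamma_n=\sup_{x_1,\dots,x_n\in\mathcal D}\tfrac12\log\det(\mathbf I_n+\mathbf K_n/\lambda),$$ and let $\mathrm{ucb}_t(x)=\min\{\mu_{t-1}(x)+\beta_t\,\sigma_{t-1}(x),\,1\}$ be the upper confidence bound in force in round $t$ (computed from the data of rounds $1,\dots,t-1$). **Theorem.** Let $\delta\in(0,1)$. Suppose that in each round $t=1,\dots,T$ the player draws $a_t$, conditionally on the past, on $z_t$ and on $a_t^-$, from the distribution $$p_t(z_t)[a]\ \propto\ \exp\Big(\eta_t\sum_{\tau=1}^{t-1}\mathrm{ucb}_\tau(a,a_\tau^{-},z_\tau)\,\mathbf 1\{z_\tau=z_t\}\Big),\qquad a\in\mathcal A,$$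 with $\beta_t=B+\sigma\lambda^{-1/2}\sqrt{2(\gamma_{t-1}+\log(2/\delta))}$ and $\eta_t=2\sqrt{\log K\big/\sum_{\tau=1}^{t}\mathbf 1\{z_\tau=z_t\}}$. Then, with probability at least $1-\delta$, $$\max_{\pi:\mathcal Z\to\mathcal A}\sum_{t=1}^T r(\pi(z_t),a_t^{-},z_t)-\sum_{t=1}^T r(a_t,a_t^{-},z_t)\ \le\ \sqrt{T\,|\mathcal Z|\log K}+\sqrt{0.5\,T\log(2/\delta)}+4\beta_T\sqrt{\gamma_T\,\lambda\,T}.$$ -/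

import Mathlib

open MeasureTheory ProbabilityTheory Finset
open scoped NNReal Matrix

namespace ContextualGame

/-! ### Kernel ridge regression -/

/-- The kernel matrix `[k(x_i, x_j)]_{i,j}` of a finite sequence of points. -/
def kernelMatrix {D : Type*} (k : D → D → ℝ) {n : ℕ} (x : Fin n → D) :
    Matrix (Fin n) (Fin n) ℝ :=
  Matrix.of fun i j => k (x i) (x j)

/-- Posterior mean at `p` from the `n` data points `(x_j, y_j)`, with regularization `lam`. -/
noncomputable def posteriorMean {D : Type*} (k : D → D → ℝ) (lam : ℝ) {n : ℕ}
    (x : Fin n → D) (y : Fin n → ℝ) (p : D) : ℝ :=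
  (fun j => k (x j) p) ⬝ᵥ ((kernelMatrix k x + lam • (1 : Matrix (Fin n) (Fin n) ℝ))⁻¹ *ᵥ y)

/-- Posterior variance at `p` from the `n` data points `x_j`, with regularization `lam`. -/
noncomputable def posteriorVar {D : Type*} (k : D → D → ℝ) (lam : ℝ) {n : ℕ}
    (x : Fin n → D) (p : D) : ℝ :=
  k p p - (fun j => k (x j) p) ⬝ᵥ
    ((kernelMatrix k x + lam • (1 : Matrix (Fin n) (Fin n) ℝ))⁻¹ *ᵥ (fun j => k (x j) p))

/-- The maximum information gain `γ_n` from `n` observations (for a kernel bounded by `1` and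
`lam > 0` this is the supremum of a nonempty set that is bounded above). -/
noncomputable def maxInfoGain {D : Type*} (k : D → D → ℝ) (lam : ℝ) (n : ℕ) : ℝ :=
  ⨆ x : Fin n → D,
    (1 / 2 : ℝ) * Real.log ((1 : Matrix (Fin n) (Fin n) ℝ) + lam⁻¹ • kernelMatrix k x).det

/-- The confidence level `β_t`, for rounds numbered `t = 1, 2, …`. -/
noncomputable def confidenceLevel {D : Type*} (k : D → D → ℝ) (lam σ B δ : ℝ) (t : ℕ) : ℝ :=
  B + σ * lam ^ (-(1 / 2) : ℝ) * √(2 * (maxInfoGain k lam (t - 1) + Real.log (2 / δ)))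

/-! ### The strategy

From here on sequences are indexed from `0`: index `t` stands for round `t + 1`, which is preceded
by exactly `t` rounds.  `A` is the action set of the player, `Opp` the set of joint actions of the
other players, `Z` the set of contexts.  `β t` is the confidence level of round `t`, with rounds
numbered from `1`. -/

/-- The upper confidence bound function in force during the round with index `t`; it is computed
from the data `(x_j, y_j)`, `j < t`, of all the earlier rounds. -/
noncomputable def ucb {D : Type*} (k : D → D → ℝ) (lam : ℝ) (β : ℕ → ℝ)
    (x : ℕ → D) (y : ℕ → ℝ) (t : ℕ) (p : D) : ℝ :=
  min (posteriorMean k lam (fun j : Fin t => x j) (fun j : Fin t => y j) p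
      + β (t + 1) * √(posteriorVar k lam (fun j : Fin t => x j) p)) 1

/-- The learning rate of the round with index `t`: `2 √(log K / m)`, where `m` is the number of
rounds up to and including this one in which its context was revealed. -/
noncomputable def learningRate {Z : Type*} [DecidableEq Z] (K : ℕ) (z : ℕ → Z) (t : ℕ) : ℝ :=
  2 * √(Real.log K / ∑ s ∈ range (t + 1), if z s = z t then (1 : ℝ) else 0)

/-- The sum of the past upper confidence bounds of action `b` over the rounds whose context is the
current one. -/
noncomputable def contextScore {A Opp Z : Type*} [DecidableEq Z]
    (k : A × Opp × Z → A × Opp × Z → ℝ) (lam : ℝ) (β : ℕ → ℝ)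
    (a : ℕ → A) (o : ℕ → Opp) (z : ℕ → Z) (y : ℕ → ℝ) (t : ℕ) (b : A) : ℝ :=
  ∑ s ∈ range t,
    if z s = z t then ucb k lam β (fun j => (a j, o j, z j)) y s (b, o s, z s) else 0

/-- The multiplicative-weights distribution on actions at the round with index `t`, given the
realized actions `a`, opponents' actions `o`, contexts `z` and observed rewards `y`.  It depends on
`a, o, y` before `t` and on `z` up to `t` only. -/
noncomputable def mwStrategy {A Opp Z : Type*} [Fintype A] [DecidableEq Z]
    (k : A × Opp × Z → A × Opp × Z → ℝ) (lam : ℝ) (β : ℕ → ℝ)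
    (a : ℕ → A) (o : ℕ → Opp) (z : ℕ → Z) (y : ℕ → ℝ) (t : ℕ) (b : A) : ℝ :=
  Real.exp (learningRate (Fintype.card A) z t * contextScore k lam β a o z y t b) /
    ∑ b' : A, Real.exp (learningRate (Fintype.card A) z t * contextScore k lam β a o z y t b')

/-! ### The repeated game -/

/-- The contextual regret after `T` rounds: the cumulative reward of the best fixed policy in
hindsight minus the cumulative reward obtained. -/
noncomputable def contextualRegret {A Opp Z : Type*} (r : A × Opp × Z → ℝ)
    (a : ℕ → A) (o : ℕ → Opp) (z : ℕ → Z) (T : ℕ) : ℝ :=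
  (⨆ π : Z → A, ∑ t ∈ range T, r (π (z t), o t, z t)) - ∑ t ∈ range T, r (a t, o t, z t)

/-- The σ-algebra generated by the actions of all players, the contexts and the noise in the rounds
before the one with index `t`. -/
abbrev history {Ω A Opp Z : Type*} [MeasurableSpace A] [MeasurableSpace Opp] [MeasurableSpace Z]
    (a : ℕ → Ω → A) (o : ℕ → Ω → Opp) (z : ℕ → Ω → Z) (ε : ℕ → Ω → ℝ) (t : ℕ) :
    MeasurableSpace Ω :=
  ⨆ s : Fin t, MeasurableSpace.comap (fun ω => (a s ω, o s ω, z s ω, ε s ω)) inferInstance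

/-- `T` rounds of a repeated contextual game with reward function `r`, in which the player samples
its actions from `strategy` and sees its rewards through `σ`-sub-Gaussian noise `ε`.  Contexts and
opponents' actions are arbitrary: they may depend on the past in any way, and on additional
randomness. -/
structure IsRepeatedPlay {Ω A Opp Z : Type*} [MeasurableSpace Ω] [MeasurableSpace A]
    [MeasurableSpace Opp] [MeasurableSpace Z] (P : Measure Ω) (T : ℕ)
    (r : A × Opp × Z → ℝ) (σ : ℝ≥0)
    (strategy : (ℕ → A) → (ℕ → Opp) → (ℕ → Z) → (ℕ → ℝ) → ℕ → A → ℝ)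
    (a : ℕ → Ω → A) (o : ℕ → Ω → Opp) (z : ℕ → Ω → Z) (ε : ℕ → Ω → ℝ) : Prop where
  measurable_action : ∀ t < T, Measurable (a t)
  measurable_opponents : ∀ t < T, Measurable (o t)
  measurable_context : ∀ t < T, Measurable (z t)
  measurable_noise : ∀ t < T, Measurable (ε t)
  /-- `E[exp(α ε_t)] ≤ exp(α² σ² / 2)` for all real `α`. -/
  noise_subgaussian : ∀ t < T, HasSubgaussianMGF (ε t) (σ ^ 2) P
  /-- The noise is independent over time, and of the moves made before it is realized. -/
  noise_indep : ∀ t < T, Indep (MeasurableSpace.comap (ε t) inferInstance)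
    (history a o z ε t ⊔
      MeasurableSpace.comap (fun ω => (a t ω, o t ω, z t ω)) inferInstance) P
  /-- Given the past, the current context and the simultaneous actions of the opponents, the
  action of the player is distributed according to the strategy, applied to the observed data
  (the observed reward of round `s` being `r (a_s, o_s, z_s) + ε_s`). -/
  action_sampled : ∀ t < T, ∀ b : A,
    P[Set.indicator {ω | a t ω = b} (fun _ => (1 : ℝ)) |
      history a o z ε t ⊔ MeasurableSpace.comap (fun ω => (o t ω, z t ω)) inferInstance]
    =ᵐ[P] fun ω => strategy (fun s => a s ω) (fun s => o s ω) (fun s => z s ω)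
      (fun s => r (a s ω, o s ω, z s ω) + ε s ω) t b

end ContextualGame

/-! The regret is compared with the upper confidence bounds clipped to `[0, 1]` and splits into
three parts. Opponents' actions are observed, so after each round the bound of every action is
known, and the player runs exponential weights with full information separately in each context;
`mw_regret_le` is the resulting deterministic estimate and gives the first term. The second term
pays for playing a sampled action instead of the mean of its distribution: given the past, the
context and the opponents' move, these differences are centred and bounded, so Azuma–Hoeffding
applies (`measureReal_sum_gt_le`). The third term is the excess of the bound over the reward at the
played points, at most `2β` times the posterior standard deviation; the posterior variances are
summed through a telescoping log-determinant (`sum_posteriorVar_le`).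

That the confidence bounds are valid has an algebraic and a probabilistic half. Algebraically, the
prediction error is at most `(‖f‖ + √(E / lam))` posterior standard deviations, where `E = eᵀ K (K +
lam I)⁻¹ e` is the energy of the noise (`abs_posteriorMean_sub_le`). Probabilistically, `exp (E /
(2σ²) - infoGain)` is a product of one-step Gaussian mixtures (`prod_mixture_eq`), each of
conditional mean at most one, so Ville's inequality controls `E` at all times simultaneously
(`measureReal_noiseEnergy_gt_le`).

The strategy uses bounds truncated only from above. On the confidence event they dominate a
nonnegative reward, so clipping at `0` changes nothing; off that event it keeps the gains bounded,
and Azuma–Hoeffding can be applied without conditioning. `contextualRegret_le` assembles the three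
parts on the good event. -/

namespace ContextualGame

/-! ### Linear algebra of kernel ridge regression -/

section Ridge

open scoped RealInnerProductSpace

/-- The regularized kernel matrix. -/
noncomputable abbrev ridgeMatrix {D : Type*} (k : D → D → ℝ) (lam : ℝ) {n : ℕ} (x : Fin n → D) :
    Matrix (Fin n) (Fin n) ℝ :=
  kernelMatrix k x + lam • (1 : Matrix (Fin n) (Fin n) ℝ)

/-- The squared self-normalized norm `eᵀ K (K + lam I)⁻¹ e` of a noise vector. -/
noncomputable def noiseEnergy {D : Type*} (k : D → D → ℝ) (lam : ℝ) {n : ℕ} (x : Fin n → D)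
    (e : Fin n → ℝ) : ℝ :=
  e ⬝ᵥ e - lam * (e ⬝ᵥ ((ridgeMatrix k lam x)⁻¹ *ᵥ e))

variable {D H : Type*} [NormedAddCommGroup H] [InnerProductSpace ℝ H]
  {k : D → D → ℝ} {φ : D → H} {lam : ℝ} {n : ℕ}

lemma ridgeMatrix_posDef (hk : ∀ x y, k x y = ⟪φ x, φ y⟫) (hlam : 0 < lam) (x : Fin n → D) :
    (ridgeMatrix k lam x).PosDef := by
  have h : kernelMatrix k x = Matrix.gram ℝ (fun j => φ (x j)) := by
    ext i j; simp [kernelMatrix, Matrix.gram, hk]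
  unfold ridgeMatrix
  rw [h]
  exact Matrix.PosDef.posSemidef_add (Matrix.posSemidef_gram ℝ _) (Matrix.PosDef.one.smul hlam)

lemma isUnit_det_ridgeMatrix (hk : ∀ x y, k x y = ⟪φ x, φ y⟫) (hlam : 0 < lam) (x : Fin n → D) :
    IsUnit (ridgeMatrix k lam x).det :=
  (ridgeMatrix_posDef hk hlam x).det_pos.ne'.isUnit

lemma ridgeMatrix_mulVec_inv (hk : ∀ x y, k x y = ⟪φ x, φ y⟫) (hlam : 0 < lam) (x : Fin n → D)
    (e : Fin n → ℝ) : ridgeMatrix k lam x *ᵥ ((ridgeMatrix k lam x)⁻¹ *ᵥ e) = e := by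
  rw [Matrix.mulVec_mulVec, Matrix.mul_nonsing_inv _ (isUnit_det_ridgeMatrix hk hlam x),
    Matrix.one_mulVec]

lemma ridgeMatrix_inv_mulVec_eq (hk : ∀ x y, k x y = ⟪φ x, φ y⟫) (hlam : 0 < lam) (x : Fin n → D)
    {e v : Fin n → ℝ} (h : ridgeMatrix k lam x *ᵥ v = e) : (ridgeMatrix k lam x)⁻¹ *ᵥ e = v := by
  rw [← h, Matrix.mulVec_mulVec, Matrix.nonsing_inv_mul _ (isUnit_det_ridgeMatrix hk hlam x),
    Matrix.one_mulVec]

lemma dotProduct_ridgeMatrix_inv_comm (hk : ∀ x y, k x y = ⟪φ x, φ y⟫) (hlam : 0 < lam)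
    (x : Fin n → D) (u v : Fin n → ℝ) :
    u ⬝ᵥ ((ridgeMatrix k lam x)⁻¹ *ᵥ v) = ((ridgeMatrix k lam x)⁻¹ *ᵥ u) ⬝ᵥ v := by
  have h : ((ridgeMatrix k lam x)⁻¹)ᵀ = (ridgeMatrix k lam x)⁻¹ := by
    simpa using (ridgeMatrix_posDef hk hlam x).inv.isHermitian.eq
  rw [Matrix.dotProduct_mulVec, ← Matrix.mulVec_transpose, h]

lemma ridgeMatrix_mulVec (x : Fin n → D) (v : Fin n → ℝ) :
    ridgeMatrix k lam x *ᵥ v = kernelMatrix k x *ᵥ v + lam • v := by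
  simp [ridgeMatrix, Matrix.add_mulVec, Matrix.smul_mulVec]

lemma dotProduct_inner (x : Fin n → D) (w : Fin n → ℝ) (f : H) :
    w ⬝ᵥ (fun j => ⟪f, φ (x j)⟫) = ⟪f, ∑ j, w j • φ (x j)⟫ := by
  simp [dotProduct, inner_sum, inner_smul_right]

lemma kernelMatrix_mulVec (hk : ∀ x y, k x y = ⟪φ x, φ y⟫) (x : Fin n → D) (w : Fin n → ℝ) :
    kernelMatrix k x *ᵥ w = fun j => ⟪∑ i, w i • φ (x i), φ (x j)⟫ := by
  ext j
  simp only [Matrix.mulVec, dotProduct, kernelMatrix, Matrix.of_apply, hk, sum_inner,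
    real_inner_smul_left]
  exact Finset.sum_congr rfl fun i _ => by rw [real_inner_comm, mul_comm]

/-- The weights with which the observations enter the posterior mean at `p`. -/
noncomputable def ridgeWeights (k : D → D → ℝ) (lam : ℝ) (x : Fin n → D) (p : D) : Fin n → ℝ :=
  (ridgeMatrix k lam x)⁻¹ *ᵥ (fun j => k (x j) p)

lemma posteriorMean_eq_dotProduct (hk : ∀ x y, k x y = ⟪φ x, φ y⟫) (hlam : 0 < lam)
    (x : Fin n → D) (y : Fin n → ℝ) (p : D) :
    posteriorMean k lam x y p = ridgeWeights k lam x p ⬝ᵥ y :=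
  dotProduct_ridgeMatrix_inv_comm hk hlam x _ _

/-- The weights solve the normal equations `(K + lam I) w = k(·, p)`; expanding the square and using
them collapses the right side. The two summands are what the target function and the noise,
respectively, are tested against by Cauchy–Schwarz. -/
lemma posteriorVar_eq (hk : ∀ x y, k x y = ⟪φ x, φ y⟫) (hlam : 0 < lam) (x : Fin n → D) (p : D) :
    posteriorVar k lam x p = ‖φ p - ∑ j, ridgeWeights k lam x p j • φ (x j)‖ ^ 2
      + lam * (ridgeWeights k lam x p ⬝ᵥ ridgeWeights k lam x p) := by
  set w := ridgeWeights k lam x p with hw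
  have h1 : kernelMatrix k x *ᵥ w + lam • w = fun j => k (x j) p := by
    rw [← ridgeMatrix_mulVec]; exact ridgeMatrix_mulVec_inv hk hlam x _
  have h2 : w ⬝ᵥ (kernelMatrix k x *ᵥ w) = ‖∑ j, w j • φ (x j)‖ ^ 2 := by
    rw [kernelMatrix_mulVec hk, dotProduct_inner, real_inner_self_eq_norm_sq]
  have h3 : w ⬝ᵥ (fun j => k (x j) p) = ⟪φ p, ∑ j, w j • φ (x j)⟫ := by
    rw [← dotProduct_inner]; simp [hk, real_inner_comm]
  have h4 : w ⬝ᵥ (fun j => k (x j) p) = w ⬝ᵥ (kernelMatrix k x *ᵥ w) + lam * (w ⬝ᵥ w) := by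
    rw [← h1, dotProduct_add, dotProduct_smul, smul_eq_mul]
  have h5 : posteriorVar k lam x p = k p p - w ⬝ᵥ (fun j => k (x j) p) := by
    rw [posteriorVar, dotProduct_comm]; rfl
  rw [h5, norm_sub_sq_real, ← h3, ← h2, hk p p, real_inner_self_eq_norm_sq]
  linarith

lemma dotProduct_self_nonneg (u : Fin n → ℝ) : 0 ≤ u ⬝ᵥ u :=
  Finset.sum_nonneg fun _ _ => mul_self_nonneg _

lemma posteriorVar_nonneg (hk : ∀ x y, k x y = ⟪φ x, φ y⟫) (hlam : 0 < lam) (x : Fin n → D)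
    (p : D) : 0 ≤ posteriorVar k lam x p := by
  rw [posteriorVar_eq hk hlam]
  have := dotProduct_self_nonneg (ridgeWeights k lam x p)
  positivity

lemma posteriorVar_le (hk : ∀ x y, k x y = ⟪φ x, φ y⟫) (hlam : 0 < lam) (x : Fin n → D)
    (p : D) : posteriorVar k lam x p ≤ k p p := by
  have h := (ridgeMatrix_posDef hk hlam x).inv.posSemidef.dotProduct_mulVec_nonneg
    (fun j => k (x j) p)
  simp only [star_trivial] at h
  unfold posteriorVar
  linarith

/-- Since `e = K v + lam v`, the energy is `eᵀ K v = |K v|² + lam vᵀ K v`. With `g = ∑ v i • φ (x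
i)`, the ridge fit of the noise, this is the squared norm of `g` plus its values on the data. -/
lemma noiseEnergy_eq (hk : ∀ x y, k x y = ⟪φ x, φ y⟫) (hlam : 0 < lam) (x : Fin n → D)
    {e v : Fin n → ℝ} (hv : ridgeMatrix k lam x *ᵥ v = e) :
    noiseEnergy k lam x e = lam * ‖∑ j, v j • φ (x j)‖ ^ 2
      + (fun j => ⟪∑ i, v i • φ (x i), φ (x j)⟫) ⬝ᵥ (fun j => ⟪∑ i, v i • φ (x i), φ (x j)⟫) := by
  rw [noiseEnergy, ridgeMatrix_inv_mulVec_eq hk hlam x hv, ← kernelMatrix_mulVec hk]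
  have h2 : v ⬝ᵥ (kernelMatrix k x *ᵥ v) = ‖∑ j, v j • φ (x j)‖ ^ 2 := by
    rw [kernelMatrix_mulVec hk, dotProduct_inner, real_inner_self_eq_norm_sq]
  rw [← h2]
  rw [ridgeMatrix_mulVec] at hv
  rw [← hv]
  simp only [add_dotProduct, dotProduct_add, smul_dotProduct, dotProduct_smul, smul_eq_mul]
  rw [dotProduct_comm (kernelMatrix k x *ᵥ v) v]
  ring

lemma sq_dotProduct_le (u v : Fin n → ℝ) : (u ⬝ᵥ v) ^ 2 ≤ (u ⬝ᵥ u) * (v ⬝ᵥ v) := by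
  simpa [dotProduct, sq] using Finset.sum_mul_sq_le_sq_mul_sq univ u v

/-- This is Cauchy–Schwarz in `H × ℝⁿ` with weight `lam` on the first factor: the pair (`g`, values
of `g` on the data) is tested against (residual of `φ p`, weights). -/
lemma sq_ridgeWeights_dotProduct_le (hk : ∀ x y, k x y = ⟪φ x, φ y⟫) (hlam : 0 < lam)
    (x : Fin n → D) (e : Fin n → ℝ) (p : D) :
    (ridgeWeights k lam x p ⬝ᵥ e) ^ 2 ≤
      noiseEnergy k lam x e * (posteriorVar k lam x p / lam) := by
  set v := (ridgeMatrix k lam x)⁻¹ *ᵥ e with hv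
  have hv' : ridgeMatrix k lam x *ᵥ v = e := ridgeMatrix_mulVec_inv hk hlam x e
  rw [noiseEnergy_eq hk hlam x hv', posteriorVar_eq hk hlam]
  set w := ridgeWeights k lam x p with hw
  set g : H := ∑ j, v j • φ (x j) with hg
  set h : Fin n → ℝ := fun j => ⟪g, φ (x j)⟫ with hh
  -- By symmetry of the inverse, the left side is the ridge fit `g` evaluated at `p`.
  have h1 : w ⬝ᵥ e = ⟪g, φ p - ∑ j, w j • φ (x j)⟫ + w ⬝ᵥ h := by
    rw [hh, dotProduct_inner, inner_sub_right, sub_add_cancel, hw, ridgeWeights,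
      ← dotProduct_ridgeMatrix_inv_comm hk hlam, ← hv, hg, real_inner_comm, ← dotProduct_inner,
      dotProduct_comm]
    simp [hk, real_inner_comm]
  have h2 : |⟪g, φ p - ∑ j, w j • φ (x j)⟫| ≤ ‖g‖ * ‖φ p - ∑ j, w j • φ (x j)‖ :=
    abs_real_inner_le_norm _ _
  have h3 := sq_dotProduct_le w h
  set c := ⟪g, φ p - ∑ j, w j • φ (x j)⟫
  set N := ‖φ p - ∑ j, w j • φ (x j)‖
  have hww := dotProduct_self_nonneg w
  have hhh := dotProduct_self_nonneg h
  have h4 : c ^ 2 ≤ (lam * ‖g‖ ^ 2) * (N ^ 2 / lam) := by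
    rw [mul_div_assoc', mul_assoc, mul_div_assoc, mul_div_cancel₀]
    · rw [← mul_pow]; exact sq_le_sq' (by linarith [neg_abs_le c]) (by linarith [le_abs_self c])
    · exact hlam.ne'
  have h5 : (N ^ 2 + lam * (w ⬝ᵥ w)) / lam = N ^ 2 / lam + w ⬝ᵥ w := by field_simp
  rw [h1, h5]
  have hA : 0 ≤ lam * ‖g‖ ^ 2 := by positivity
  have hB : 0 ≤ N ^ 2 / lam := by positivity
  generalize lam * ‖g‖ ^ 2 = α at *
  generalize N ^ 2 / lam = β at *
  generalize w ⬝ᵥ h = d at *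
  generalize w ⬝ᵥ w = γ at *
  generalize h ⬝ᵥ h = η at *
  -- The cross term of `(c + d) ^ 2` is bounded by the cross terms `α * γ + η * β` of the product,
  -- by AM–GM.
  have h6 : (c * d) ^ 2 ≤ (α * γ) * (η * β) := by
    rw [mul_pow]
    calc c ^ 2 * d ^ 2 ≤ (α * β) * (γ * η) := by gcongr
      _ = _ := by ring
  have h7 : 2 * (c * d) ≤ α * γ + η * β := by
    have h8 : (c * d) ^ 2 ≤ ((α * γ + η * β) / 2) ^ 2 := by
      nlinarith [sq_nonneg (α * γ - η * β)]
    have := abs_le_of_sq_le_sq h8 (by positivity)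
    linarith [le_abs_self (c * d)]
  nlinarith

/-- The confidence bound of kernel ridge regression in terms of the realized noise. -/
lemma abs_posteriorMean_sub_le (hk : ∀ x y, k x y = ⟪φ x, φ y⟫) (hlam : 0 < lam)
    (x : Fin n → D) (e : Fin n → ℝ) (f : H) (p : D) :
    |posteriorMean k lam x (fun j => ⟪f, φ (x j)⟫ + e j) p - ⟪f, φ p⟫| ≤
      (‖f‖ + √(noiseEnergy k lam x e / lam)) * √(posteriorVar k lam x p) := by
  rw [posteriorMean_eq_dotProduct hk hlam]
  set w := ridgeWeights k lam x p with hw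
  have h1 : w ⬝ᵥ (fun j => ⟪f, φ (x j)⟫ + e j) - ⟪f, φ p⟫
      = - ⟪f, φ p - ∑ j, w j • φ (x j)⟫ + w ⬝ᵥ e := by
    rw [inner_sub_right, ← dotProduct_inner]
    have : (fun j => ⟪f, φ (x j)⟫ + e j) = (fun j => ⟪f, φ (x j)⟫) + e := rfl
    rw [this, dotProduct_add]; ring
  have h2 : |⟪f, φ p - ∑ j, w j • φ (x j)⟫| ≤ ‖f‖ * √(posteriorVar k lam x p) := by
    refine (abs_real_inner_le_norm _ _).trans ?_
    gcongr
    apply Real.le_sqrt_of_sq_le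
    rw [posteriorVar_eq hk hlam]
    have := dotProduct_self_nonneg w
    have : 0 ≤ lam * (w ⬝ᵥ w) := by positivity
    linarith
  have h3 : |w ⬝ᵥ e| ≤ √(noiseEnergy k lam x e / lam) * √(posteriorVar k lam x p) := by
    rw [← Real.sqrt_mul' _ (posteriorVar_nonneg hk hlam x p)]
    apply Real.abs_le_sqrt
    refine (sq_ridgeWeights_dotProduct_le hk hlam x e p).trans (le_of_eq ?_)
    ring
  rw [h1]
  refine (abs_add_le _ _).trans ?_
  rw [abs_neg, add_mul]
  exact add_le_add h2 h3

end Ridge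

/-! ### One more observation -/

section Recursion

open scoped RealInnerProductSpace

variable {D H : Type*} [NormedAddCommGroup H] [InnerProductSpace ℝ H]
  {k : D → D → ℝ} {φ : D → H} {lam : ℝ}

lemma dotProduct_fin_succ {n : ℕ} (u v : Fin (n + 1) → ℝ) :
    u ⬝ᵥ v = (fun j : Fin n => u j.castSucc) ⬝ᵥ (fun j => v j.castSucc)
      + u (Fin.last n) * v (Fin.last n) := by
  simp [dotProduct, Fin.sum_univ_castSucc]

lemma ridgeMatrix_succ_mulVec_snoc (hk : ∀ x y, k x y = k y x) (x : ℕ → D) (n : ℕ)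
    (v : Fin n → ℝ) (c : ℝ) :
    ridgeMatrix k lam (fun j : Fin (n + 1) => x j) *ᵥ (Fin.snoc v c : Fin (n + 1) → ℝ) =
      (Fin.snoc (ridgeMatrix k lam (fun j : Fin n => x j) *ᵥ v + c • fun j : Fin n => k (x j) (x n))
        ((fun j : Fin n => k (x j) (x n)) ⬝ᵥ v + c * (k (x n) (x n) + lam)) :
          Fin (n + 1) → ℝ) := by
  ext i
  rw [ridgeMatrix_mulVec, ridgeMatrix_mulVec]
  refine Fin.lastCases ?_ (fun i => ?_) i
  · simp [Matrix.mulVec, kernelMatrix, dotProduct_fin_succ]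
    have : (fun j : Fin n => k (x n) (x j)) = fun j : Fin n => k (x j) (x n) := by
      ext j; exact hk _ _
    rw [this]; ring
  · simp [Matrix.mulVec, kernelMatrix, dotProduct_fin_succ]
    ring

lemma add_posteriorVar_pos (hk : ∀ x y, k x y = ⟪φ x, φ y⟫) (hlam : 0 < lam) {n : ℕ}
    (x : Fin n → D) (p : D) : 0 < lam + posteriorVar k lam x p :=
  add_pos_of_pos_of_nonneg hlam (posteriorVar_nonneg hk hlam x p)

/-- The effect of one more observation on the noise energy. -/
lemma noiseEnergy_succ (hk : ∀ x y, k x y = ⟪φ x, φ y⟫) (hlam : 0 < lam) (x : ℕ → D)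
    (e : ℕ → ℝ) (n : ℕ) :
    noiseEnergy k lam (fun j : Fin (n + 1) => x j) (fun j => e j) =
      noiseEnergy k lam (fun j : Fin n => x j) (fun j => e j) +
        (posteriorVar k lam (fun j : Fin n => x j) (x n) / lam * e n ^ 2
          + 2 * posteriorMean k lam (fun j : Fin n => x j) (fun j => e j) (x n) * e n
          - posteriorMean k lam (fun j : Fin n => x j) (fun j => e j) (x n) ^ 2) /
        (1 + posteriorVar k lam (fun j : Fin n => x j) (x n) / lam) := by
  set xs : Fin n → D := fun j => x j with hxs
  set es : Fin n → ℝ := fun j => e j with hes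
  set kv : Fin n → ℝ := fun j => k (x j) (x n) with hkv
  have hpos := add_posteriorVar_pos hk hlam xs (x n)
  have hmean : posteriorMean k lam xs es (x n) = kv ⬝ᵥ ((ridgeMatrix k lam xs)⁻¹ *ᵥ es) := rfl
  have hvar : posteriorVar k lam xs (x n)
      = k (x n) (x n) - kv ⬝ᵥ ((ridgeMatrix k lam xs)⁻¹ *ᵥ kv) := rfl
  set m := posteriorMean k lam xs es (x n)
  set s := posteriorVar k lam xs (x n)
  set v := (ridgeMatrix k lam xs)⁻¹ *ᵥ es with hv
  set w := (ridgeMatrix k lam xs)⁻¹ *ᵥ kv with hw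
  -- Last coordinate of the solution of the bordered system: prediction residual over Schur
  -- complement.
  set c := (e n - m) / (lam + s) with hc
  have hsol : (ridgeMatrix k lam (fun j : Fin (n + 1) => x j))⁻¹ *ᵥ (fun j => e j)
      = (Fin.snoc (v - c • w) c : Fin (n + 1) → ℝ) := by
    apply ridgeMatrix_inv_mulVec_eq hk hlam
    rw [ridgeMatrix_succ_mulVec_snoc (fun a b => by rw [hk, hk, real_inner_comm]),
      Matrix.mulVec_sub, Matrix.mulVec_smul, ridgeMatrix_mulVec_inv hk hlam,
      ridgeMatrix_mulVec_inv hk hlam, sub_add_cancel, dotProduct_sub, dotProduct_smul, ← hmean]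
    ext i
    refine Fin.lastCases ?_ (fun i => ?_) i
    · have h1 : c * (lam + s) = e n - m := by rw [hc]; field_simp
      simp only [Fin.snoc_last, Fin.val_last, smul_eq_mul]
      rw [hvar] at h1
      linarith
    · simp [hes]
  have hsymm : es ⬝ᵥ w = m := by
    rw [hw, dotProduct_ridgeMatrix_inv_comm hk hlam, dotProduct_comm, hmean]
  have h2 : (lam + s) ≠ 0 := hpos.ne'
  have h3 : (1 + s / lam) ≠ 0 := by
    have : 1 + s / lam = (lam + s) / lam := by field_simp
    rw [this]; positivity
  rw [noiseEnergy, noiseEnergy, hsol, dotProduct_fin_succ, dotProduct_fin_succ]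
  simp only [Fin.snoc_castSucc, Fin.snoc_last, Fin.val_last, Fin.val_castSucc]
  change es ⬝ᵥ es + e n * e n - lam * (es ⬝ᵥ (v - c • w) + e n * c) = _
  rw [dotProduct_sub, dotProduct_smul, hsymm, smul_eq_mul, hc]
  field_simp
  ring

/-- The Schur complement of the old block in the bordered matrix is exactly `lam` plus the posterior
variance at the new point. -/
lemma det_ridgeMatrix_succ (hk : ∀ x y, k x y = ⟪φ x, φ y⟫) (hlam : 0 < lam) (x : ℕ → D)
    (n : ℕ) :
    (ridgeMatrix k lam (fun j : Fin (n + 1) => x j)).det =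
      (ridgeMatrix k lam (fun j : Fin n => x j)).det *
        (lam + posteriorVar k lam (fun j : Fin n => x j) (x n)) := by
  set xs : Fin n → D := fun j => x j with hxs
  set kv : Fin n → ℝ := fun j => k (x j) (x n) with hkv
  have := (ridgeMatrix k lam xs).invertibleOfIsUnitDet (isUnit_det_ridgeMatrix hk hlam xs)
  have h : (ridgeMatrix k lam (fun j : Fin (n + 1) => x j)).submatrix
      finSumFinEquiv finSumFinEquiv =
      Matrix.fromBlocks (ridgeMatrix k lam xs) (Matrix.of fun i (_ : Fin 1) => kv i)
        (Matrix.of fun (_ : Fin 1) i => kv i)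
        (Matrix.of fun (_ _ : Fin 1) => k (x n) (x n) + lam) := by
    ext i j
    rcases i with i | i <;> rcases j with j | j
    · simp [kernelMatrix, Matrix.one_apply, hxs, Fin.ext_iff]
    · have : (i : ℕ) ≠ n := i.2.ne
      simp [kernelMatrix, hkv, Fin.ext_iff, this]
    · have : (n : ℕ) ≠ j := j.2.ne'
      simp [kernelMatrix, hkv, Fin.ext_iff, this]
      rw [hk, hk, real_inner_comm]
    · simp [kernelMatrix, Matrix.one_apply, Fin.ext_iff]
  rw [← Matrix.det_submatrix_equiv_self finSumFinEquiv, h, Matrix.det_fromBlocks₁₁,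
    Matrix.invOf_eq_nonsing_inv, Matrix.det_unique (n := Fin 1)]
  congr 1
  have h2 : (Matrix.of fun (_ : Fin 1) i => kv i) * (ridgeMatrix k lam xs)⁻¹ *
      (Matrix.of fun i (_ : Fin 1) => kv i) =
      Matrix.of fun (_ _ : Fin 1) => kv ⬝ᵥ ((ridgeMatrix k lam xs)⁻¹ *ᵥ kv) := by
    rw [Matrix.mul_assoc]
    ext i j
    rfl
  rw [h2]
  have hvar : posteriorVar k lam xs (x n)
      = k (x n) (x n) - kv ⬝ᵥ ((ridgeMatrix k lam xs)⁻¹ *ᵥ kv) := rfl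
  rw [hvar]
  simp
  ring

lemma det_one_add_kernelMatrix (hlam : 0 < lam) {n : ℕ} (x : Fin n → D) :
    ((1 : Matrix (Fin n) (Fin n) ℝ) + lam⁻¹ • kernelMatrix k x).det =
      lam⁻¹ ^ n * (ridgeMatrix k lam x).det := by
  have h : (1 : Matrix (Fin n) (Fin n) ℝ) + lam⁻¹ • kernelMatrix k x
      = lam⁻¹ • ridgeMatrix k lam x := by
    rw [ridgeMatrix, smul_add, smul_smul, inv_mul_cancel₀ hlam.ne', one_smul, add_comm]
  rw [h, Matrix.det_smul, Fintype.card_fin]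

/-- The information gain of a sequence of points. -/
noncomputable def infoGain (k : D → D → ℝ) (lam : ℝ) {n : ℕ} (x : Fin n → D) : ℝ :=
  (1 / 2 : ℝ) * Real.log ((1 : Matrix (Fin n) (Fin n) ℝ) + lam⁻¹ • kernelMatrix k x).det

lemma infoGain_succ (hk : ∀ x y, k x y = ⟪φ x, φ y⟫) (hlam : 0 < lam) (x : ℕ → D) (n : ℕ) :
    infoGain k lam (fun j : Fin (n + 1) => x j) = infoGain k lam (fun j : Fin n => x j)
      + 1 / 2 * Real.log (1 + posteriorVar k lam (fun j : Fin n => x j) (x n) / lam) := by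
  have h1 := (ridgeMatrix_posDef hk hlam (fun j : Fin n => x j)).det_pos
  have h2 := add_posteriorVar_pos hk hlam (fun j : Fin n => x j) (x n)
  have h3 : 1 + posteriorVar k lam (fun j : Fin n => x j) (x n) / lam
      = lam⁻¹ * (lam + posteriorVar k lam (fun j : Fin n => x j) (x n)) := by field_simp
  rw [infoGain, infoGain, det_one_add_kernelMatrix hlam, det_one_add_kernelMatrix hlam,
    det_ridgeMatrix_succ hk hlam, h3, ← mul_add, ← Real.log_mul (by positivity) (by positivity)]
  congr 2
  rw [pow_succ]
  ring

lemma infoGain_zero (x : ℕ → D) : infoGain k lam (fun j : Fin 0 => x j) = 0 := by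
  simp [infoGain]

/-- Crude Leibniz bound: `n!` products of entries of size at most `2`. Without boundedness the real
supremum would be a junk value. -/
lemma bddAbove_infoGain (hk : ∀ x y, k x y = ⟪φ x, φ y⟫) (hlam : 1 ≤ lam)
    (hbdd : ∀ x y, |k x y| ≤ 1) (n : ℕ) :
    BddAbove (Set.range fun x : Fin n → D => infoGain k lam x) := by
  refine ⟨1 / 2 * Real.log (n.factorial * 2 ^ n), ?_⟩
  rintro _ ⟨x, rfl⟩
  have hpos : 0 < ((1 : Matrix (Fin n) (Fin n) ℝ) + lam⁻¹ • kernelMatrix k x).det := by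
    have hl : 0 < lam := by linarith
    rw [det_one_add_kernelMatrix hl]
    have := (ridgeMatrix_posDef hk hl x).det_pos
    positivity
  have hdet : ((1 : Matrix (Fin n) (Fin n) ℝ) + lam⁻¹ • kernelMatrix k x).det
      ≤ n.factorial * 2 ^ n := by
    refine (le_abs_self _).trans ?_
    have := Matrix.det_le (abv := AbsoluteValue.abs)
      (A := (1 : Matrix (Fin n) (Fin n) ℝ) + lam⁻¹ • kernelMatrix k x) (x := 2) ?_
    · simpa using this
    · intro i j
      have h1 : |lam⁻¹ * k (x i) (x j)| ≤ 1 := by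
        rw [abs_mul, abs_of_nonneg (by positivity)]
        exact mul_le_one₀ (inv_le_one_of_one_le₀ hlam) (abs_nonneg _) (hbdd _ _)
      have h2 : |(1 : Matrix (Fin n) (Fin n) ℝ) i j| ≤ 1 := by
        rw [Matrix.one_apply]; split_ifs <;> simp
      simp only [AbsoluteValue.abs_apply, Matrix.add_apply, Matrix.smul_apply, kernelMatrix,
        Matrix.of_apply, smul_eq_mul]
      exact (abs_add_le _ _).trans (by linarith)
  exact mul_le_mul_of_nonneg_left (Real.log_le_log hpos hdet) (by norm_num)

lemma infoGain_le_maxInfoGain (hk : ∀ x y, k x y = ⟪φ x, φ y⟫) (hlam : 1 ≤ lam)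
    (hbdd : ∀ x y, |k x y| ≤ 1) {n : ℕ} (x : Fin n → D) :
    infoGain k lam x ≤ maxInfoGain k lam n :=
  le_ciSup (bddAbove_infoGain hk hlam hbdd n) x

/-- Append an arbitrary point: it adds the logarithm of a factor at least one. -/
lemma maxInfoGain_mono [Nonempty D] (hk : ∀ x y, k x y = ⟪φ x, φ y⟫) (hlam : 1 ≤ lam)
    (hbdd : ∀ x y, |k x y| ≤ 1) : Monotone (maxInfoGain k lam) := by
  refine monotone_nat_of_le_succ fun n => ?_
  refine ciSup_le fun x => ?_
  have hl : 0 < lam := by linarith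
  set x' : ℕ → D := fun j => if h : j < n then x ⟨j, h⟩ else Classical.arbitrary D with hx'
  have hx : x = fun j : Fin n => x' j := by ext j; simp [hx']
  refine le_trans ?_ (infoGain_le_maxInfoGain hk hlam hbdd (fun j : Fin (n + 1) => x' j))
  rw [infoGain_succ hk hl, hx]
  have h : 0 ≤ posteriorVar k lam (fun j : Fin n => x' j) (x' n) / lam :=
    div_nonneg (posteriorVar_nonneg hk hl _ _) hl.le
  have := Real.log_nonneg (le_add_of_nonneg_right h)
  change infoGain k lam (fun j : Fin n => x' j) ≤ _
  linarith

lemma half_le_log_one_add {s : ℝ} (h0 : 0 ≤ s) (h1 : s ≤ 1) : s / 2 ≤ Real.log (1 + s) := by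
  have h := Real.one_sub_inv_le_log_of_pos (show 0 < 1 + s by linarith)
  refine le_trans ?_ h
  rw [div_le_iff₀ two_pos, one_sub_mul, inv_mul_eq_div, le_sub_comm, div_le_iff₀ (by linarith)]
  nlinarith

/-- Each `v / lam` lies in `[0, 1]` because the kernel is at most `1 ≤ lam`, so `v ≤ 2 * lam * log
(1 + v / lam)`, which is `4 * lam` times the increment of the information gain. -/
lemma sum_posteriorVar_le (hk : ∀ x y, k x y = ⟪φ x, φ y⟫) (hlam : 1 ≤ lam)
    (hbdd : ∀ x y, |k x y| ≤ 1) (x : ℕ → D) (n : ℕ) :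
    ∑ t ∈ range n, posteriorVar k lam (fun j : Fin t => x j) (x t)
      ≤ 4 * (lam * infoGain k lam (fun j : Fin n => x j)) := by
  have hl : 0 < lam := by linarith
  induction n with
  | zero => simp [infoGain_zero]
  | succ n ih =>
    rw [Finset.sum_range_succ, infoGain_succ hk hl]
    set v := posteriorVar k lam (fun j : Fin n => x j) (x n)
    have h0 : 0 ≤ v / lam := div_nonneg (posteriorVar_nonneg hk hl _ _) hl.le
    have h1 : v / lam ≤ 1 := by
      rw [div_le_one hl]
      exact ((posteriorVar_le hk hl _ _).trans ((le_abs_self _).trans (hbdd _ _))).trans hlam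
    have h2 := half_le_log_one_add h0 h1
    have h3 : v = lam * (v / lam) := by field_simp
    have h4 : lam * (v / lam / 2) ≤ lam * Real.log (1 + v / lam) := by gcongr
    rw [mul_add, mul_add]
    linarith

end Recursion

/-! ### Multiplicative weights -/

section MultiplicativeWeights

variable {A : Type*} [Fintype A]

/-- Hoeffding's lemma for a finite distribution. -/
lemma sum_mul_exp_le {p u : A → ℝ} (hp : ∀ b, 0 ≤ p b) (hp1 : ∑ b, p b = 1)
    (hu : ∀ b, u b ∈ Set.Icc (0 : ℝ) 1) (l : ℝ) :
    ∑ b, p b * Real.exp (l * (u b - ∑ b', p b' * u b')) ≤ Real.exp (l ^ 2 / 8) := by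
  let _ : MeasurableSpace A := ⊤
  have hq : ∑ b, ENNReal.ofReal (p b) = 1 := by
    rw [← ENNReal.ofReal_sum_of_nonneg fun b _ => hp b, hp1, ENNReal.ofReal_one]
  let q : PMF A := PMF.ofFintype (fun b => ENNReal.ofReal (p b)) hq
  have hint (f : A → ℝ) : ∫ b, f b ∂q.toMeasure = ∑ b, p b * f b := by
    rw [PMF.integral_eq_sum]
    exact Finset.sum_congr rfl fun b _ => by
      simp [q, PMF.ofFintype_apply, ENNReal.toReal_ofReal (hp b)]
  have h := (hasSubgaussianMGF_of_mem_Icc (μ := q.toMeasure) (X := u) (a := 0) (b := 1)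
    (measurable_of_finite u).aemeasurable (Filter.Eventually.of_forall hu)).mgf_le l
  rw [mgf, hint, hint] at h
  refine h.trans (le_of_eq ?_)
  congr 1
  norm_num
  ring

variable [Nonempty A]

/-- The exponential-weights potential at learning rate `η` of the cumulative gains `L`. -/
noncomputable def potential (η : ℝ) (L : A → ℝ) : ℝ :=
  η⁻¹ * Real.log (∑ b, (Fintype.card A : ℝ)⁻¹ * Real.exp (η * L b))

lemma sum_exp_pos (η : ℝ) (L : A → ℝ) :
    0 < ∑ b, (Fintype.card A : ℝ)⁻¹ * Real.exp (η * L b) :=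
  Finset.sum_pos (fun _ _ => by positivity) univ_nonempty

/-- The potential is the logarithm of the `η`-power mean of `exp (L b)` under the uniform
distribution, so this is the power mean inequality. It is what accommodates learning rates that
decrease over time. -/
lemma potential_mono {η η' : ℝ} (hη : 0 < η) (h : η ≤ η') (L : A → ℝ) :
    potential η L ≤ potential η' L := by
  have hη' : 0 < η' := hη.trans_le h
  have hcard : ∑ _b : A, (Fintype.card A : ℝ)⁻¹ = 1 := by simp
  have h1 := Real.rpow_arith_mean_le_arith_mean_rpow univ (fun _ : A => (Fintype.card A : ℝ)⁻¹)
    (fun b => Real.exp (η * L b)) (fun _ _ => by positivity) hcard (fun _ _ => by positivity)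
    (p := η' / η) (by rwa [le_div_iff₀ hη, one_mul])
  have h2 : ∀ b, Real.exp (η * L b) ^ (η' / η) = Real.exp (η' * L b) := fun b => by
    rw [← Real.exp_mul]; congr 1; field_simp
  simp only [h2] at h1
  have h3 := Real.log_le_log (Real.rpow_pos_of_pos (sum_exp_pos η L) _) h1
  rw [Real.log_rpow (sum_exp_pos η L)] at h3
  unfold potential
  rw [inv_mul_eq_div, inv_mul_eq_div, div_le_div_iff₀ hη hη']
  rw [div_mul_eq_mul_div, div_le_iff₀ hη] at h3
  linarith

lemma le_potential_add {η : ℝ} (hη : 0 < η) (L : A → ℝ) (b : A) :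
    L b ≤ potential η L + Real.log (Fintype.card A) / η := by
  have hK : (0 : ℝ) < Fintype.card A := by exact_mod_cast Fintype.card_pos
  have h1 : (Fintype.card A : ℝ)⁻¹ * Real.exp (η * L b) ≤
      ∑ b, (Fintype.card A : ℝ)⁻¹ * Real.exp (η * L b) :=
    Finset.single_le_sum (f := fun b => (Fintype.card A : ℝ)⁻¹ * Real.exp (η * L b))
      (fun _ _ => by positivity) (mem_univ b)
  have h2 := Real.log_le_log (by positivity) h1
  rw [Real.log_mul (by positivity) (by positivity), Real.log_exp, Real.log_inv] at h2
  unfold potential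
  rw [inv_mul_eq_div, ← add_div, le_div_iff₀ hη]
  linarith

/-- The exponential-weights distribution. -/
noncomputable def expWeights (η : ℝ) (L : A → ℝ) (b : A) : ℝ :=
  Real.exp (η * L b) / ∑ b', Real.exp (η * L b')

lemma expWeights_nonneg (η : ℝ) (L : A → ℝ) (b : A) : 0 ≤ expWeights η L b := by
  unfold expWeights; positivity

lemma sum_expWeights (η : ℝ) (L : A → ℝ) : ∑ b, expWeights η L b = 1 := by
  unfold expWeights
  rw [← Finset.sum_div, div_self]
  exact (Finset.sum_pos (fun _ _ => by positivity) univ_nonempty).ne'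

/-- The increment is `η⁻¹` times the log-moment generating function of `u` under the current
weights; Hoeffding's lemma bounds that by mean plus `η ^ 2 / 8`. -/
lemma potential_add_le {η : ℝ} (hη : 0 < η) (L : A → ℝ) {u : A → ℝ}
    (hu : ∀ b, u b ∈ Set.Icc (0 : ℝ) 1) :
    potential η (fun b => L b + u b) ≤
      potential η L + ∑ b, expWeights η L b * u b + η / 8 := by
  set m := ∑ b, expWeights η L b * u b with hm
  have hS : 0 < ∑ b, Real.exp (η * L b) :=
    Finset.sum_pos (fun _ _ => by positivity) univ_nonempty
  have h1 : ∑ b, (Fintype.card A : ℝ)⁻¹ * Real.exp (η * (L b + u b)) =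
      (∑ b, (Fintype.card A : ℝ)⁻¹ * Real.exp (η * L b)) * (Real.exp (η * m) *
        ∑ b, expWeights η L b * Real.exp (η * (u b - m))) := by
    rw [← Finset.mul_sum, ← Finset.mul_sum, mul_assoc]
    congr 1
    rw [← mul_assoc, Finset.mul_sum]
    refine Finset.sum_congr rfl fun b _ => ?_
    rw [expWeights, mul_add, mul_sub, Real.exp_add, Real.exp_sub]
    field_simp
  have h2 := sum_mul_exp_le (expWeights_nonneg η L) (sum_expWeights η L) hu η
  rw [← hm] at h2
  have h3 : 0 < ∑ b, expWeights η L b * Real.exp (η * (u b - m)) :=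
    Finset.sum_pos (fun b _ => by unfold expWeights; positivity) univ_nonempty
  have h4 := Real.log_le_log h3 h2
  rw [Real.log_exp] at h4
  unfold potential
  rw [h1, Real.log_mul (sum_exp_pos η L).ne' (by positivity), Real.log_mul (by positivity) h3.ne',
    Real.log_exp, mul_add, add_assoc]
  gcongr
  rw [mul_add, inv_mul_cancel_left₀ hη.ne']
  gcongr
  rw [inv_mul_le_iff₀ hη]
  linarith

variable {Z : Type*} [DecidableEq Z]

/-- The number of rounds before `t` with context `c`. -/
noncomputable def contextCount (z : ℕ → Z) (t : ℕ) (c : Z) : ℝ :=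
  ∑ s ∈ range t, if z s = c then (1 : ℝ) else 0

lemma contextCount_nonneg (z : ℕ → Z) (t : ℕ) (c : Z) : 0 ≤ contextCount z t c :=
  Finset.sum_nonneg fun _ _ => by split_ifs <;> norm_num

lemma contextCount_succ (z : ℕ → Z) (t : ℕ) (c : Z) :
    contextCount z (t + 1) c = contextCount z t c + if z t = c then 1 else 0 :=
  Finset.sum_range_succ _ _

/-- The multiplicative-weights distribution for the gains `u`. -/
noncomputable def mwWeights (u : ℕ → A → ℝ) (z : ℕ → Z) (t : ℕ) : A → ℝ :=
  expWeights (learningRate (Fintype.card A) z t)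
    (fun b => ∑ s ∈ range t, if z s = z t then u s b else 0)

lemma learningRate_eq (K : ℕ) (z : ℕ → Z) (t : ℕ) :
    learningRate K z t = 2 * √(Real.log K / (contextCount z t (z t) + 1)) := by
  have : ∑ s ∈ range (t + 1), (if z s = z t then (1 : ℝ) else 0) = contextCount z t (z t) + 1 := by
    rw [Finset.sum_range_succ, if_pos rfl]; rfl
  rw [learningRate, this]

/-- Makes the sum of the learning rates telescope; it amounts to `(√(m + 1) - √m) ^ 2 ≥ 0`. -/
lemma sqrt_add_inv_le {m : ℝ} (hm : 0 ≤ m) : √m + (√(m + 1))⁻¹ / 2 ≤ √(m + 1) := by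
  have h1 : 0 < √(m + 1) := Real.sqrt_pos.2 (by linarith)
  have h2 := Real.sq_sqrt hm
  have h3 := Real.sq_sqrt (show 0 ≤ m + 1 by linarith)
  have h4 : (√(m + 1))⁻¹ / 2 = 1 / (2 * √(m + 1)) := by field_simp
  rw [h4, ← le_sub_iff_add_le', div_le_iff₀ (by positivity)]
  nlinarith [sq_nonneg (√(m + 1) - √m)]

/-- The rate `η` is left free so that, in the induction, it can be raised to the rate actually used
in the current round. The constraint on it is multiplicative rather than a quotient, hence void
while the context has not yet appeared. -/
lemma potential_le_of_context {u : ℕ → A → ℝ} {z : ℕ → Z} {T : ℕ}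
    (hlog : 0 < Real.log (Fintype.card A))
    (hu : ∀ t < T, ∀ b, u t b ∈ Set.Icc (0 : ℝ) 1) (c : Z) {η : ℝ} (hη : 0 < η)
    (hηT : η * √(contextCount z T c) ≤ 2 * √(Real.log (Fintype.card A))) :
    potential η (fun b => ∑ t ∈ range T, if z t = c then u t b else 0) ≤
      (∑ t ∈ range T, if z t = c then ∑ b, mwWeights u z t b * u t b else 0)
        + √(Real.log (Fintype.card A)) * √(contextCount z T c) / 2 := by
  induction T generalizing η with
  | zero =>
    simp [potential, contextCount]
  | succ T ih =>
    have ih' := fun {η : ℝ} (hη : 0 < η) h => ih (fun t ht => hu t (ht.trans (Nat.lt_succ_self T)))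
      (η := η) hη h
    simp only [Finset.sum_range_succ, contextCount_succ] at hηT ⊢
    by_cases hc : z T = c
    · simp only [hc, if_true] at hηT ⊢
      set m := contextCount z T c with hm
      have hm0 : 0 ≤ m := contextCount_nonneg z T c
      set l := √(Real.log (Fintype.card A)) with hl
      have hl0 : 0 < l := Real.sqrt_pos.2 hlog
      have hs : 0 < √(m + 1) := Real.sqrt_pos.2 (by linarith)
      have hrate : learningRate (Fintype.card A) z T = 2 * (l / √(m + 1)) := by
        rw [learningRate_eq, hc, Real.sqrt_div hlog.le]
      set η' := 2 * (l / √(m + 1)) with hη'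
      have hη'0 : 0 < η' := by positivity
      have h1 : η ≤ η' := by
        rw [hη', mul_div_assoc', le_div_iff₀ hs]; exact hηT
      have h2 : η' * √m ≤ 2 * l := by
        have : √m ≤ √(m + 1) := Real.sqrt_le_sqrt (by linarith)
        calc η' * √m ≤ η' * √(m + 1) := by gcongr
          _ = 2 * l := by rw [hη']; field_simp
      refine (potential_mono hη h1 _).trans ((potential_add_le hη'0 _ (hu T (by simp))).trans ?_)
      have h3 : mwWeights u z T = expWeights η'
          (fun b => ∑ t ∈ range T, if z t = c then u t b else 0) := by
        rw [mwWeights, hrate, hc]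
      rw [h3]
      have h4 := ih' hη'0 h2
      have h5 := mul_le_mul_of_nonneg_left (sqrt_add_inv_le hm0) hl0.le
      -- The Hoeffding cost of the round is half of `l` times the increment in `sqrt_add_inv_le`.
      have h6 : η' / 8 = l * ((√(m + 1))⁻¹ / 2) / 2 := by rw [hη']; field_simp; norm_num
      rw [h6]
      linarith
    · simp only [hc, if_false, add_zero] at hηT ⊢
      exact ih' hη hηT

lemma context_regret_le {u : ℕ → A → ℝ} {z : ℕ → Z} {T : ℕ}
    (hlog : 0 < Real.log (Fintype.card A))
    (hu : ∀ t < T, ∀ b, u t b ∈ Set.Icc (0 : ℝ) 1) (c : Z) (b : A) :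
    (∑ t ∈ range T, if z t = c then u t b else 0) -
      (∑ t ∈ range T, if z t = c then ∑ b, mwWeights u z t b * u t b else 0) ≤
        √(Real.log (Fintype.card A)) * √(contextCount z T c) := by
  rcases (contextCount_nonneg z T c).eq_or_lt with h0 | h0
  · have h1 : (∑ t ∈ range T, if z t = c then u t b else 0) ≤ contextCount z T c := by
      refine Finset.sum_le_sum fun t ht => ?_
      split_ifs
      · exact (hu t (mem_range.1 ht) b).2
      · exact le_rfl
    have h2 : 0 ≤ ∑ t ∈ range T, if z t = c then ∑ b, mwWeights u z t b * u t b else 0 := by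
      refine Finset.sum_nonneg fun t ht => ?_
      split_ifs
      · exact Finset.sum_nonneg fun b _ =>
          mul_nonneg (expWeights_nonneg _ _ _) (hu t (mem_range.1 ht) b).1
      · exact le_rfl
    rw [← h0] at h1 ⊢
    simp only [Real.sqrt_zero, mul_zero]
    linarith
  · set l := √(Real.log (Fintype.card A)) with hl
    have hl0 : 0 < l := Real.sqrt_pos.2 hlog
    have hl2 : l ^ 2 = Real.log (Fintype.card A) := Real.sq_sqrt hlog.le
    have hs : 0 < √(contextCount z T c) := Real.sqrt_pos.2 h0
    -- At this rate the accumulated Hoeffding cost and the prior cost `log K / η` each contribute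
    -- half of the bound.
    have hη : 0 < 2 * l / √(contextCount z T c) := by positivity
    have h1 := potential_le_of_context (z := z) hlog hu c hη (by rw [div_mul_cancel₀ _ hs.ne'])
    have h2 := le_potential_add hη (fun b => ∑ t ∈ range T, if z t = c then u t b else 0) b
    have h3 : Real.log (Fintype.card A) / (2 * l / √(contextCount z T c))
        = l * √(contextCount z T c) / 2 := by
      rw [← hl2]; field_simp
    rw [h3] at h2
    linarith

lemma sum_contextCount [Fintype Z] (z : ℕ → Z) (T : ℕ) : ∑ c, contextCount z T c = T := by
  unfold contextCount
  rw [Finset.sum_comm]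
  simp

/-- The contextual regret of multiplicative weights with decreasing learning rates. -/
lemma mw_regret_le [Fintype Z] {u : ℕ → A → ℝ} {z : ℕ → Z} {T : ℕ}
    (hu : ∀ t < T, ∀ b, u t b ∈ Set.Icc (0 : ℝ) 1) (π : Z → A) :
    ∑ t ∈ range T, u t (π (z t)) - ∑ t ∈ range T, ∑ b, mwWeights u z t b * u t b ≤
      √(T * Fintype.card Z * Real.log (Fintype.card A)) := by
  have hK : 1 ≤ Fintype.card A := Fintype.card_pos
  rcases hK.eq_or_lt with h1 | h1
  -- With a single action the learning rate is zero and the potential argument breaks down, but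
  -- there is no regret at all.
  · have : Subsingleton A := Fintype.card_le_one_iff_subsingleton.1 h1.ge
    have h2 : ∀ t, ∑ b, mwWeights u z t b * u t b = u t (π (z t)) := fun t => by
      have h3 : ∀ b, u t b = u t (π (z t)) := fun b => by rw [Subsingleton.elim b]
      simp only [h3]
      rw [← Finset.sum_mul, mwWeights, sum_expWeights, one_mul]
    simp only [h2, sub_self]
    positivity
  · have hlog : 0 < Real.log (Fintype.card A) := Real.log_pos (by exact_mod_cast h1)
    have hsplit : ∀ f : ℕ → Z → ℝ, ∑ t ∈ range T, f t (z t) =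
        ∑ c, ∑ t ∈ range T, if z t = c then f t c else 0 := fun f => by
      rw [Finset.sum_comm]; simp
    rw [hsplit (fun t c => u t (π c)), hsplit (fun t _ => ∑ b, mwWeights u z t b * u t b),
      ← Finset.sum_sub_distrib]
    refine (Finset.sum_le_sum fun c _ => context_regret_le hlog hu c (π c)).trans ?_
    rw [← Finset.mul_sum, mul_comm (T * _ : ℝ), Real.sqrt_mul hlog.le]
    gcongr
    apply Real.le_sqrt_of_sq_le
    -- Cauchy–Schwarz over contexts, whose counts add up to `T`.
    refine (sq_sum_le_card_mul_sum_sq).trans (le_of_eq ?_)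
    simp_rw [Real.sq_sqrt (contextCount_nonneg z T _)]
    rw [sum_contextCount, Finset.card_univ, mul_comm]

end MultiplicativeWeights

/-! ### Probabilistic inequalities -/

section Probability

open scoped ENNReal

lemma lintegral_exp_quadratic {b : ℝ} (hb : 0 < b) (c : ℝ) :
    ∫⁻ x : ℝ, ENNReal.ofReal (Real.exp (-b * x ^ 2 + c * x)) =
      ENNReal.ofReal (√(Real.pi / b) * Real.exp (c ^ 2 / (4 * b))) := by
  have h1 : ∀ x : ℝ, ENNReal.ofReal (Real.exp (-b * x ^ 2 + c * x)) =
      ENNReal.ofReal (Real.exp (c ^ 2 / (4 * b))) *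
        ENNReal.ofReal (Real.exp (-b * (x - c / (2 * b)) ^ 2)) := fun x => by
    rw [← ENNReal.ofReal_mul (by positivity), ← Real.exp_add]
    congr 2
    field_simp
    ring
  simp_rw [h1]
  rw [lintegral_const_mul _ (by fun_prop),
    lintegral_sub_right_eq_self (fun x : ℝ => ENNReal.ofReal (Real.exp (-b * x ^ 2))) (c / (2 * b)),
    ← ofReal_integral_eq_lintegral_ofReal (integrable_exp_neg_mul_sq hb)
      (Filter.Eventually.of_forall fun _ => (Real.exp_pos _).le), integral_gaussian,
    ← ENNReal.ofReal_mul (by positivity), mul_comm]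

/-- The one-dimensional method of mixtures for a sub-Gaussian distribution. -/
lemma lintegral_exp_mixture_le {ν : Measure ℝ} [SFinite ν] {σ : ℝ} (hσ : 0 < σ)
    (hν : ∀ α, ∫⁻ e, ENNReal.ofReal (Real.exp (α * e)) ∂ν ≤
      ENNReal.ofReal (Real.exp (σ ^ 2 * α ^ 2 / 2))) {s : ℝ} (hs : 0 ≤ s) (m : ℝ) :
    ∫⁻ e, ENNReal.ofReal (Real.exp ((s * e ^ 2 + 2 * m * e - m ^ 2) / (1 + s) / (2 * σ ^ 2))) ∂ν ≤
      ENNReal.ofReal √(1 + s) := by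
  rcases hs.eq_or_lt with rfl | hs
  -- For `s = 0` the mixing Gaussian is a point mass and the hypothesis is used only at `α = m / σ ^
  -- 2`.
  · have h1 : ∀ e : ℝ, ENNReal.ofReal
        (Real.exp ((0 * e ^ 2 + 2 * m * e - m ^ 2) / (1 + 0) / (2 * σ ^ 2))) =
        ENNReal.ofReal (Real.exp (-(m ^ 2 / (2 * σ ^ 2)))) *
          ENNReal.ofReal (Real.exp (m / σ ^ 2 * e)) := fun e => by
      rw [← ENNReal.ofReal_mul (by positivity), ← Real.exp_add]
      congr 2
      field_simp
      ring
    simp_rw [h1]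
    rw [lintegral_const_mul _ (by fun_prop)]
    refine (mul_le_mul_right (hν _) _).trans ?_
    rw [← ENNReal.ofReal_mul (by positivity), ← Real.exp_add]
    have : -(m ^ 2 / (2 * σ ^ 2)) + σ ^ 2 * (m / σ ^ 2) ^ 2 / 2 = 0 := by field_simp; ring
    rw [this]
    simp
  · set b := (1 + s) / (2 * s * σ ^ 2) with hb
    have hb0 : 0 < b := by positivity
    set C := √(Real.pi / b) with hC
    have hC0 : 0 < C := by positivity
    have hC1 : ENNReal.ofReal C ≠ 0 := by simpa using hC0
    refine (ENNReal.mul_le_mul_iff_right hC1 ENNReal.ofReal_ne_top).1 ?_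
    -- The integrand on the right is the unnormalized density of `N(m, s σ²)` at `g` times `exp (g e
    -- / σ² - g² / (2σ²))`. After Tonelli, the integral of the latter over `e` is at most one; the
    -- ratio of the two Gaussian normalizers is `√(1 + s)`.
    have h1 : ∀ e : ℝ, ENNReal.ofReal C * ENNReal.ofReal
        (Real.exp ((s * e ^ 2 + 2 * m * e - m ^ 2) / (1 + s) / (2 * σ ^ 2))) =
        ∫⁻ g : ℝ, ENNReal.ofReal (Real.exp (-(m ^ 2 / (2 * s * σ ^ 2)))) * ENNReal.ofReal
          (Real.exp (-b * g ^ 2 + (e / σ ^ 2 + m / (s * σ ^ 2)) * g)) := fun e => by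
      rw [lintegral_const_mul _ (by fun_prop), lintegral_exp_quadratic hb0,
        ← ENNReal.ofReal_mul (by positivity), ← ENNReal.ofReal_mul (by positivity), ← hC,
        mul_left_comm, ← Real.exp_add]
      congr 3
      rw [hb]
      field_simp
      ring
    rw [← lintegral_const_mul _ (by fun_prop)]
    simp_rw [h1]
    rw [lintegral_lintegral_swap (by fun_prop)]
    have h2 : ∀ g : ℝ, ∫⁻ e, ENNReal.ofReal (Real.exp (-(m ^ 2 / (2 * s * σ ^ 2)))) *
        ENNReal.ofReal (Real.exp (-b * g ^ 2 + (e / σ ^ 2 + m / (s * σ ^ 2)) * g)) ∂ν ≤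
        ENNReal.ofReal (Real.exp (-(m ^ 2 / (2 * s * σ ^ 2)))) *
          ENNReal.ofReal (Real.exp (-(2 * s * σ ^ 2)⁻¹ * g ^ 2 + m / (s * σ ^ 2) * g)) := fun g => by
      rw [lintegral_const_mul _ (by fun_prop)]
      refine mul_le_mul_right ?_ _
      have h3 : ∀ e : ℝ, ENNReal.ofReal
          (Real.exp (-b * g ^ 2 + (e / σ ^ 2 + m / (s * σ ^ 2)) * g)) =
          ENNReal.ofReal (Real.exp (-b * g ^ 2 + m / (s * σ ^ 2) * g)) *
            ENNReal.ofReal (Real.exp (g / σ ^ 2 * e)) := fun e => by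
        rw [← ENNReal.ofReal_mul (by positivity), ← Real.exp_add]
        congr 2
        ring
      simp_rw [h3]
      rw [lintegral_const_mul _ (by fun_prop)]
      refine (mul_le_mul_right (hν _) _).trans (le_of_eq ?_)
      rw [← ENNReal.ofReal_mul (by positivity), ← Real.exp_add]
      congr 2
      rw [hb]
      field_simp
      ring
    refine (lintegral_mono h2).trans (le_of_eq ?_)
    rw [lintegral_const_mul _ (by fun_prop), lintegral_exp_quadratic (by positivity),
      ← ENNReal.ofReal_mul (by positivity), ← ENNReal.ofReal_mul (by positivity), mul_left_comm,
      ← Real.exp_add]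
    have h4 : -(m ^ 2 / (2 * s * σ ^ 2)) + (m / (s * σ ^ 2)) ^ 2 / (4 * (2 * s * σ ^ 2)⁻¹) = 0 := by
      field_simp
      ring
    rw [h4, Real.exp_zero, mul_one, hC, ← Real.sqrt_mul (by positivity)]
    congr 2
    rw [hb]
    field_simp

variable {Ω : Type*} {m mΩ : MeasurableSpace Ω} {P : Measure Ω}

lemma lintegral_eq_of_indepFun [IsProbabilityMeasure P] {Ω' : Type*} [MeasurableSpace Ω']
    {X : Ω → Ω'} {ε : Ω → ℝ} (hX : Measurable X) (hε : Measurable ε) (h : IndepFun X ε P)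
    {f : Ω' × ℝ → ℝ≥0∞} (hf : Measurable f) :
    ∫⁻ ω, f (X ω, ε ω) ∂P = ∫⁻ ω, ∫⁻ e, f (X ω, e) ∂(P.map ε) ∂P := by
  have hprob : IsProbabilityMeasure (P.map ε) := Measure.isProbabilityMeasure_map hε.aemeasurable
  rw [← lintegral_map (f := f) (g := fun ω => (X ω, ε ω)) hf (hX.prodMk hε),
    (indepFun_iff_map_prod_eq_prod_map_map hX.aemeasurable hε.aemeasurable).1 h,
    lintegral_prod _ hf.aemeasurable, lintegral_map hf.lintegral_prod_right' hX]

/-- Integrating out a noise variable that is independent of a sub-σ-algebra. -/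
lemma lintegral_eq_of_indep [IsProbabilityMeasure P] (hm : m ≤ mΩ)
    {ε : Ω → ℝ} (hε : Measurable ε)
    (hindep : Indep (MeasurableSpace.comap ε inferInstance) m P) {f : Ω × ℝ → ℝ≥0∞}
    (hf : Measurable[m.prod inferInstance] f) :
    ∫⁻ ω, f (ω, ε ω) ∂P = ∫⁻ ω, ∫⁻ e, f (ω, e) ∂(P.map ε) ∂P := by
  -- The identity, viewed as a map from `mΩ` to the smaller σ-algebra `m`, is a random variable that
  -- generates `m`.
  refine @lintegral_eq_of_indepFun Ω mΩ P _ Ω m id ε (measurable_id'' hm) hε ?_ f hf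
  refine (@IndepFun_iff_Indep Ω Ω ℝ mΩ m _ id ε P).2 ?_
  rw [MeasurableSpace.comap_id]
  exact hindep.symm

/-- Everything except `ε` is `m`-measurable and can be frozen, leaving the one-dimensional mixture
bound. Testing against every `m`-measurable `N` expresses "conditional mean at most one" without
integrability conditions. -/
lemma lintegral_mul_mixture_le [IsProbabilityMeasure P] (hm : m ≤ mΩ)
    {ε : Ω → ℝ} (hε : Measurable ε)
    (hindep : Indep (MeasurableSpace.comap ε inferInstance) m P) {σ : ℝ≥0} (hσ : 0 < σ)
    (hsub : HasSubgaussianMGF ε (σ ^ 2) P) {N : Ω → ℝ≥0∞} (hN : Measurable[m] N) {s μ : Ω → ℝ}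
    (hs : Measurable[m] s) (hμ : Measurable[m] μ) (hs0 : ∀ ω, 0 ≤ s ω) :
    ∫⁻ ω, N ω * ENNReal.ofReal
      (Real.exp ((s ω * ε ω ^ 2 + 2 * μ ω * ε ω - μ ω ^ 2) / (1 + s ω) / (2 * σ ^ 2)) /
        √(1 + s ω)) ∂P ≤ ∫⁻ ω, N ω ∂P := by
  have hf : @Measurable (Ω × ℝ) ℝ≥0∞ (m.prod inferInstance) _ (fun q : Ω × ℝ => N q.1 *
      ENNReal.ofReal (Real.exp ((s q.1 * q.2 ^ 2 + 2 * μ q.1 * q.2 - μ q.1 ^ 2) / (1 + s q.1) /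
        (2 * (σ : ℝ) ^ 2)) / √(1 + s q.1))) := by
    let _ := m
    fun_prop
  rw [lintegral_eq_of_indep hm hε hindep hf]
  refine lintegral_mono fun ω => ?_
  have hprob : IsProbabilityMeasure (P.map ε) := Measure.isProbabilityMeasure_map hε.aemeasurable
  have hν : ∀ α, ∫⁻ e, ENNReal.ofReal (Real.exp (α * e)) ∂(P.map ε) ≤
      ENNReal.ofReal (Real.exp ((σ : ℝ) ^ 2 * α ^ 2 / 2)) := fun α => by
    rw [lintegral_map (by fun_prop) hε, ← ofReal_integral_eq_lintegral_ofReal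
      (hsub.integrable_exp_mul α) (Filter.Eventually.of_forall fun _ => (Real.exp_pos _).le)]
    refine ENNReal.ofReal_le_ofReal ((hsub.mgf_le α).trans (le_of_eq ?_))
    norm_num
  have hmix := lintegral_exp_mixture_le (ν := P.map ε) (σ := σ) (by exact_mod_cast hσ) hν
    (hs0 ω) (μ ω)
  have hpos : 0 < √(1 + s ω) := Real.sqrt_pos.2 (by linarith [hs0 ω])
  simp only [div_eq_mul_inv _ (√(1 + s ω))]
  simp_rw [ENNReal.ofReal_mul (Real.exp_pos _).le]
  rw [lintegral_const_mul _ (by fun_prop), lintegral_mul_const _ (by fun_prop)]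
  calc _ ≤ N ω * (ENNReal.ofReal √(1 + s ω) * ENNReal.ofReal (√(1 + s ω))⁻¹) := by
        gcongr
    _ = N ω := by
        rw [← ENNReal.ofReal_mul hpos.le, mul_inv_cancel₀ hpos.ne', ENNReal.ofReal_one, mul_one]

/-- Ville's maximal inequality for a product of conditionally subunit factors. -/
lemma mul_measure_exists_le_le_one [IsProbabilityMeasure P] {T : ℕ} {G : ℕ → MeasurableSpace Ω}
    (hG : ∀ t < T, G t ≤ mΩ) {M Y : ℕ → Ω → ℝ≥0∞}
    (hM : ∀ t < T, ∀ s ≤ t, Measurable[G t] (M s)) (hM0 : ∫⁻ ω, M 0 ω ∂P ≤ 1)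
    (hstep : ∀ t < T, ∀ N : Ω → ℝ≥0∞, Measurable[G t] N →
      ∫⁻ ω, N ω * Y t ω ∂P ≤ ∫⁻ ω, N ω ∂P)
    (hMY : ∀ t < T, ∀ ω, M (t + 1) ω = M t ω * Y t ω) (c : ℝ≥0∞) :
    c * P {ω | ∃ t < T, c ≤ M t ω} ≤ 1 := by
  set S : ℕ → Set Ω := fun n => {ω | ∃ t < n, c ≤ M t ω} with hS
  have hSm : ∀ t < T, ∀ n ≤ t + 1, MeasurableSet[G t] (S n) := fun t ht n hn => by
    have : S n = ⋃ s ∈ Finset.range n, {ω | c ≤ M s ω} := by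
      ext ω; simp [hS]
    rw [this]
    refine Finset.measurableSet_biUnion _ fun s hs => ?_
    exact measurableSet_le measurable_const (hM t ht s (by have := mem_range.1 hs; omega))
  -- The left side is a lower bound for the mean of the process stopped at its first crossing of
  -- `c`.
  have key : ∀ n ≤ T, c * P (S n) + ∫⁻ ω, (S n)ᶜ.indicator (M n) ω ∂P ≤ 1 := by
    intro n
    induction n with
    | zero =>
      intro _
      have : S 0 = ∅ := by ext ω; simp [hS]
      simpa [this] using hM0
    | succ n ih =>
      intro hn
      have hnT : n < T := hn
      refine le_trans ?_ (ih hnT.le)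
      have hm1 := hSm n hnT (n + 1) le_rfl
      have hm0 := hSm n hnT n (Nat.le_succ n)
      -- `S (n + 1)` involves the process only up to time `n`, so its indicator may be absorbed into
      -- the test function of `hstep`.
      have h1 : ∫⁻ ω, (S (n + 1))ᶜ.indicator (M (n + 1)) ω ∂P ≤
          ∫⁻ ω, (S (n + 1))ᶜ.indicator (M n) ω ∂P := by
        refine le_trans (le_of_eq ?_) (hstep n hnT _ ((hM n hnT n le_rfl).indicator hm1.compl))
        refine lintegral_congr fun ω => ?_
        by_cases h : ω ∈ (S (n + 1))ᶜ
        · rw [Set.indicator_of_mem h, Set.indicator_of_mem h, hMY n hnT]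
        · rw [Set.indicator_of_notMem h, Set.indicator_of_notMem h, zero_mul]
      have h2 : c * P (S (n + 1) \ S n) + ∫⁻ ω, (S (n + 1))ᶜ.indicator (M n) ω ∂P ≤
          ∫⁻ ω, (S n)ᶜ.indicator (M n) ω ∂P := by
        have hd : MeasurableSet (S (n + 1) \ S n) := hG n hnT _ (hm1.diff hm0)
        rw [← lintegral_indicator_const hd, ← lintegral_add_left (measurable_const.indicator hd)]
        refine lintegral_mono fun ω => ?_
        by_cases h : ω ∈ S n
        · have h' : ω ∈ S (n + 1) := by
            obtain ⟨t, ht, hc⟩ := h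
            exact ⟨t, ht.trans (Nat.lt_succ_self n), hc⟩
          simp [h, h']
        · by_cases h' : ω ∈ S (n + 1)
          · obtain ⟨t, ht, hc⟩ := h'
            have htn : t = n := by
              by_contra hne
              exact h ⟨t, by omega, hc⟩
            subst htn
            have h' : ω ∈ S (t + 1) := ⟨t, ht, hc⟩
            simpa [h, h'] using hc
          · simp [h, h']
      have h3 : P (S (n + 1)) ≤ P (S n) + P (S (n + 1) \ S n) := by
        refine (measure_mono ?_).trans (measure_union_le _ _)
        rw [Set.union_sdiff_self]
        exact Set.subset_union_right
      calc _ ≤ c * (P (S n) + P (S (n + 1) \ S n))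
            + ∫⁻ ω, (S (n + 1))ᶜ.indicator (M n) ω ∂P := by gcongr
        _ = c * P (S n) + (c * P (S (n + 1) \ S n)
            + ∫⁻ ω, (S (n + 1))ᶜ.indicator (M n) ω ∂P) := by rw [mul_add, add_assoc]
        _ ≤ _ := by gcongr
  exact le_self_add.trans (key T le_rfl)

variable {A : Type*} [Fintype A] [MeasurableSpace A] [MeasurableSingletonClass A]

/-- One step of the Azuma–Hoeffding argument for an action sampled from `p`. -/
lemma integral_mul_exp_le [IsProbabilityMeasure P] (hm : m ≤ mΩ)
    {a : Ω → A} (ha : Measurable a) {p u : A → Ω → ℝ} (hp : ∀ b, Measurable[m] (p b))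
    (hu : ∀ b, Measurable[m] (u b)) (hp0 : ∀ b ω, 0 ≤ p b ω) (hp1 : ∀ ω, ∑ b, p b ω = 1)
    (hu01 : ∀ b ω, u b ω ∈ Set.Icc (0 : ℝ) 1)
    (hcond : ∀ b, P[Set.indicator {ω | a ω = b} (fun _ => (1 : ℝ)) | m] =ᵐ[P] p b)
    {W : Ω → ℝ} (hW : Measurable[m] W) (hW0 : ∀ ω, 0 ≤ W ω) {C : ℝ} (hWC : ∀ ω, W ω ≤ C) (l : ℝ) :
    ∫ ω, W ω * Real.exp (l * (∑ b, p b ω * u b ω - u (a ω) ω)) ∂P ≤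
      Real.exp (l ^ 2 / 8) * ∫ ω, W ω ∂P := by
  set F : A → Ω → ℝ := fun b ω => W ω * Real.exp (l * (∑ b, p b ω * u b ω - u b ω)) with hF
  have hmean : ∀ ω, ∑ b, p b ω * u b ω ∈ Set.Icc (0 : ℝ) 1 := fun ω => by
    refine ⟨Finset.sum_nonneg fun b _ => mul_nonneg (hp0 b ω) (hu01 b ω).1, ?_⟩
    rw [← hp1 ω]
    exact Finset.sum_le_sum fun b _ => mul_le_of_le_one_right (hp0 b ω) (hu01 b ω).2
  have hFm : ∀ b, Measurable[m] (F b) := fun b => by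
    let _ := m
    have := fun b => hp b
    have := fun b => hu b
    fun_prop
  have hFb : ∀ b ω, |F b ω| ≤ C * Real.exp |l| := fun b ω => by
    rw [hF, abs_of_nonneg (mul_nonneg (hW0 ω) (Real.exp_pos _).le)]
    have h1 : |∑ b, p b ω * u b ω - u b ω| ≤ 1 := by
      have := hmean ω; have := hu01 b ω
      rw [abs_le]; constructor <;> linarith [(hmean ω).1, (hmean ω).2, (hu01 b ω).1, (hu01 b ω).2]
    have h2 : l * (∑ b, p b ω * u b ω - u b ω) ≤ |l| := by
      refine (le_abs_self _).trans ?_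
      rw [abs_mul]
      exact mul_le_of_le_one_right (abs_nonneg _) h1
    gcongr
    · exact (hW0 ω).trans (hWC ω)
    · exact hWC ω
  have hFint : ∀ b, Integrable (F b) P := fun b =>
    Integrable.of_bound ((hFm b).mono hm le_rfl).aestronglyMeasurable (C * Real.exp |l|)
      (Filter.Eventually.of_forall fun ω => hFb b ω)
  have hset : ∀ b, MeasurableSet {ω | a ω = b} := fun b => ha (measurableSet_singleton b)
  have hIint : ∀ b, Integrable (Set.indicator {ω | a ω = b} (fun _ => (1 : ℝ))) P := fun b =>
    (integrable_const 1).indicator (hset b)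
  have hFI : ∀ b, Integrable (F b * Set.indicator {ω | a ω = b} (fun _ => (1 : ℝ))) P := fun b => by
    have : F b * Set.indicator {ω | a ω = b} (fun _ => (1 : ℝ)) = {ω | a ω = b}.indicator (F b) := by
      ext ω; by_cases h : a ω = b <;> simp [h]
    rw [this]
    exact (hFint b).indicator (hset b)
  have hpb : ∀ b ω, p b ω ≤ 1 := fun b ω => by
    rw [← hp1 ω]; exact Finset.single_le_sum (fun b _ => hp0 b ω) (mem_univ b)
  have hFp : ∀ b, Integrable (fun ω => F b ω * p b ω) P := fun b =>
    Integrable.of_bound (((hFm b).mul (hp b)).mono hm le_rfl).aestronglyMeasurable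
      (C * Real.exp |l|) (Filter.Eventually.of_forall fun ω => by
        rw [Real.norm_eq_abs, abs_mul, abs_of_nonneg (hp0 b ω)]
        exact (mul_le_of_le_one_right (abs_nonneg _) (hpb b ω)).trans (hFb b ω))
  have h1 : ∀ ω, W ω * Real.exp (l * (∑ b, p b ω * u b ω - u (a ω) ω)) =
      ∑ b, (F b * Set.indicator {ω | a ω = b} (fun _ => (1 : ℝ))) ω := fun ω => by
    symm
    refine (Finset.sum_eq_single (a ω) (fun b _ hb => ?_) (by simp)).trans ?_
    · simp [hb.symm]
    · simp [hF]
  -- `F b` is `m`-measurable, so conditioning replaces the indicator of the sampled action by its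
  -- probability.
  have h2 : ∀ b, ∫ ω, (F b * Set.indicator {ω | a ω = b} (fun _ => (1 : ℝ))) ω ∂P =
      ∫ ω, F b ω * p b ω ∂P := fun b => by
    rw [← integral_condExp hm]
    refine integral_congr_ae ?_
    refine (condExp_mul_of_stronglyMeasurable_left (hFm b).stronglyMeasurable (hFI b)
      (hIint b)).trans ?_
    filter_upwards [hcond b] with ω hω
    rw [Pi.mul_apply, hω]
  simp_rw [h1]
  rw [integral_finsetSum _ fun b _ => hFI b]
  simp_rw [h2]
  rw [← integral_finsetSum _ fun b _ => hFp b, ← integral_const_mul]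
  have hWint : Integrable W P :=
    Integrable.of_bound (hW.mono hm le_rfl).aestronglyMeasurable C
      (Filter.Eventually.of_forall fun ω => by
        rw [Real.norm_eq_abs, abs_of_nonneg (hW0 ω)]; exact hWC ω)
  refine integral_mono (integrable_finsetSum _ fun b _ => hFp b) (hWint.const_mul _) fun ω => ?_
  have h3 := sum_mul_exp_le (fun b => hp0 b ω) (hp1 ω) (fun b => hu01 b ω) (-l)
  rw [neg_sq] at h3
  calc ∑ b, F b ω * p b ω
      = W ω * ∑ b, p b ω * Real.exp (-l * (u b ω - ∑ b', p b' ω * u b' ω)) := by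
        rw [Finset.mul_sum]
        refine Finset.sum_congr rfl fun b _ => ?_
        have : -l * (u b ω - ∑ b', p b' ω * u b' ω) = l * (∑ b, p b ω * u b ω - u b ω) := by ring
        rw [this]
        simp only [hF]
        ring
    _ ≤ W ω * Real.exp (l ^ 2 / 8) := mul_le_mul_of_nonneg_left h3 (hW0 ω)
    _ = _ := mul_comm _ _

/-- The Azuma–Hoeffding inequality for actions sampled from the distributions `p t`. -/
lemma measureReal_sum_gt_le [IsProbabilityMeasure P] {T : ℕ} {G : ℕ → MeasurableSpace Ω}
    (hG : ∀ t < T, G t ≤ mΩ) {a : ℕ → Ω → A} (ha : ∀ t < T, Measurable (a t))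
    {p u : ℕ → A → Ω → ℝ} (hp : ∀ t < T, ∀ s ≤ t, ∀ b, Measurable[G t] (p s b))
    (hu : ∀ t < T, ∀ s ≤ t, ∀ b, Measurable[G t] (u s b))
    (hua : ∀ t < T, ∀ s < t, Measurable[G t] fun ω => u s (a s ω) ω)
    (hp0 : ∀ t b ω, 0 ≤ p t b ω) (hp1 : ∀ t ω, ∑ b, p t b ω = 1)
    (hu01 : ∀ t b ω, u t b ω ∈ Set.Icc (0 : ℝ) 1)
    (hcond : ∀ t < T, ∀ b,
      P[Set.indicator {ω | a t ω = b} (fun _ => (1 : ℝ)) | G t] =ᵐ[P] p t b)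
    {δ : ℝ} (hδ0 : 0 < δ) (hδ1 : δ ≤ 1) :
    P.real {ω | √(0.5 * T * Real.log (1 / δ)) <
      ∑ t ∈ range T, (∑ b, p t b ω * u t b ω - u t (a t ω) ω)} ≤ δ := by
  set d : ℕ → Ω → ℝ := fun t ω => ∑ b, p t b ω * u t b ω - u t (a t ω) ω with hd
  have hd1 : ∀ t ω, |d t ω| ≤ 1 := fun t ω => by
    have h0 : 0 ≤ ∑ b, p t b ω * u t b ω :=
      Finset.sum_nonneg fun b _ => mul_nonneg (hp0 t b ω) (hu01 t b ω).1
    have h1 : ∑ b, p t b ω * u t b ω ≤ 1 := by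
      rw [← hp1 t ω]
      exact Finset.sum_le_sum fun b _ => mul_le_of_le_one_right (hp0 t b ω) (hu01 t b ω).2
    have := hu01 t (a t ω) ω
    rw [abs_le]
    constructor <;> linarith [this.1, this.2]
  have hdm : ∀ t < T, ∀ s < t, Measurable[G t] (d s) := fun t ht s hs => by
    have h1 := fun b => hp t ht s hs.le b
    have h2 := fun b => hu t ht s hs.le b
    have h3 := hua t ht s hs
    exact (Finset.measurable_sum _ fun b _ => (h1 b).mul (h2 b)).sub h3
  rcases Nat.eq_zero_or_pos T with rfl | hT
  · simp [hδ0.le]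
  have hT' : (0 : ℝ) < T := by exact_mod_cast hT
  have key : ∀ (l : ℝ), ∀ n ≤ T, ∫ ω, Real.exp (l * ∑ t ∈ range n, d t ω) ∂P ≤
      Real.exp (n * (l ^ 2 / 8)) := fun l n => by
    induction n with
    | zero => intro _; simp
    | succ n ih =>
      intro hn
      have hnT : n < T := hn
      have hm : Measurable[G n] fun ω => Real.exp (l * ∑ t ∈ range n, d t ω) := by
        have h1 : Measurable[G n] fun ω => ∑ t ∈ range n, d t ω :=
          Finset.measurable_sum _ fun s hs => hdm n hnT s (mem_range.1 hs)
        let _ := G n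
        fun_prop
      have hb : ∀ ω, Real.exp (l * ∑ t ∈ range n, d t ω) ≤ Real.exp (|l| * n) := fun ω => by
        refine Real.exp_le_exp.2 ((le_abs_self _).trans ?_)
        rw [abs_mul]
        gcongr
        refine (Finset.abs_sum_le_sum_abs _ _).trans ?_
        refine (Finset.sum_le_sum fun t _ => hd1 t ω).trans ?_
        simp
      have h := integral_mul_exp_le (hG n hnT) (ha n hnT) (fun b => hp n hnT n le_rfl b)
        (fun b => hu n hnT n le_rfl b) (hp0 n) (hp1 n) (hu01 n) (hcond n hnT) hm
        (fun ω => (Real.exp_pos _).le) hb l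
      have h2 : ∀ ω, Real.exp (l * ∑ t ∈ range (n + 1), d t ω) =
          Real.exp (l * ∑ t ∈ range n, d t ω) *
            Real.exp (l * (∑ b, p n b ω * u n b ω - u n (a n ω) ω)) := fun ω => by
        rw [← Real.exp_add, ← mul_add, Finset.sum_range_succ]
      simp_rw [h2]
      refine h.trans ?_
      calc _ ≤ Real.exp (l ^ 2 / 8) * Real.exp (n * (l ^ 2 / 8)) := by gcongr; exact ih hnT.le
        _ = _ := by rw [← Real.exp_add]; congr 1; push_cast; ring
  have hda : ∀ t < T, AEStronglyMeasurable (d t) P := fun t ht => by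
    have h1 : Measurable (fun ω => u t (a t ω) ω) := by
      have h2 : Measurable (fun q : A × Ω => u t q.1 q.2) :=
        measurable_from_prod_countable_right fun b => (hu t ht t le_rfl b).mono (hG t ht) le_rfl
      exact h2.comp ((ha t ht).prodMk measurable_id)
    have h3 := fun b => (hp t ht t le_rfl b).mono (hG t ht) le_rfl
    have h4 := fun b => (hu t ht t le_rfl b).mono (hG t ht) le_rfl
    have : Measurable (d t) := (Finset.measurable_sum _ fun b _ => (h3 b).mul (h4 b)).sub h1
    exact this.aestronglyMeasurable
  set L := Real.log (1 / δ) with hL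
  have hL0 : 0 ≤ L := Real.log_nonneg (by rwa [le_div_iff₀ hδ0, one_mul])
  set x := √(0.5 * T * L) with hx
  have hx2 : x ^ 2 = 0.5 * T * L := Real.sq_sqrt (by positivity)
  -- The parameter `4 * x / T` minimizes the Chernoff exponent `-l * x + T * l ^ 2 / 8`, whose
  -- minimum `-2 * x ^ 2 / T` equals `-L`.
  have hl0 : 0 ≤ 4 * x / T := by positivity
  have hsum : AEStronglyMeasurable (fun ω => ∑ t ∈ range T, d t ω) P := by
    have : AEStronglyMeasurable (∑ t ∈ range T, d t) P :=
      Finset.aestronglyMeasurable_sum _ fun t ht => hda t (mem_range.1 ht)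
    convert this using 2
    simp
  have hint : Integrable (fun ω => Real.exp (4 * x / T * ∑ t ∈ range T, d t ω)) P := by
    refine Integrable.of_bound (Real.continuous_exp.comp_aestronglyMeasurable
      (hsum.const_mul _)) (Real.exp (|4 * x / T| * T)) (Filter.Eventually.of_forall fun ω => ?_)
    rw [Real.norm_eq_abs, abs_of_pos (Real.exp_pos _)]
    refine Real.exp_le_exp.2 ((le_abs_self _).trans ?_)
    rw [abs_mul]
    gcongr
    refine (Finset.abs_sum_le_sum_abs _ _).trans ?_
    refine (Finset.sum_le_sum fun t _ => hd1 t ω).trans ?_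
    simp
  have hch := measure_ge_le_exp_mul_mgf (μ := P) (X := fun ω => ∑ t ∈ range T, d t ω) x hl0 hint
  refine (measureReal_mono (s₂ := {ω | x ≤ ∑ t ∈ range T, d t ω})
    (fun ω (hω : x < ∑ t ∈ range T, d t ω) =>
      show x ≤ ∑ t ∈ range T, d t ω from hω.le)).trans (hch.trans ?_)
  have hk := key (4 * x / T) T le_rfl
  rw [mgf]
  calc _ ≤ Real.exp (-(4 * x / T) * x) * Real.exp (T * ((4 * x / T) ^ 2 / 8)) := by gcongr
    _ = Real.exp (-L) := by
      rw [← Real.exp_add]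
      congr 1
      have : -(4 * x / T) * x + T * ((4 * x / T) ^ 2 / 8) = - 2 * x ^ 2 / T := by
        field_simp; ring
      rw [this, hx2]
      field_simp
      norm_num
    _ = δ := by rw [hL, one_div, Real.log_inv, neg_neg, Real.exp_log hδ0]

end Probability

/-! ### Measurability -/

section Measurability

variable {Ω D : Type*} [MeasurableSpace Ω] [MeasurableSpace D] {k : D → D → ℝ} {lam : ℝ} {n : ℕ}

lemma measurable_matrix_det {M : Ω → Matrix (Fin n) (Fin n) ℝ}
    (hM : ∀ i j, Measurable fun ω => M ω i j) : Measurable fun ω => (M ω).det := by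
  simp_rw [Matrix.det_apply']
  exact Finset.measurable_sum _ fun s _ =>
    (Finset.measurable_prod _ fun i _ => hM (s i) i).const_mul _

/-- By Cramer's rule the entries are quotients of determinants; the value at singular matrices is
covered by the convention for division by zero. -/
lemma measurable_matrix_inv {M : Ω → Matrix (Fin n) (Fin n) ℝ}
    (hM : ∀ i j, Measurable fun ω => M ω i j) (i j : Fin n) :
    Measurable fun ω => (M ω)⁻¹ i j := by
  simp_rw [Matrix.inv_def, Ring.inverse_eq_inv', Matrix.smul_apply, Matrix.adjugate_apply,
    smul_eq_mul]
  refine (measurable_matrix_det hM).inv.mul (measurable_matrix_det fun i' j' => ?_)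
  by_cases h : i' = j
  · subst h
    simp
  · simpa [Matrix.updateRow_ne h] using hM i' j'

lemma measurable_dotProduct_mulVec {M : Ω → Matrix (Fin n) (Fin n) ℝ}
    (hM : ∀ i j, Measurable fun ω => M ω i j) {u v : Ω → Fin n → ℝ}
    (hu : ∀ i, Measurable fun ω => u ω i) (hv : ∀ i, Measurable fun ω => v ω i) :
    Measurable fun ω => u ω ⬝ᵥ (M ω *ᵥ v ω) := by
  simp only [dotProduct, Matrix.mulVec]
  fun_prop

lemma measurable_kernel_comp (hk : Measurable fun p : D × D => k p.1 p.2)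
    {f g : Ω → D} (hf : Measurable f) (hg : Measurable g) :
    Measurable fun ω => k (f ω) (g ω) :=
  hk.comp (hf.prodMk hg)

lemma measurable_ridgeMatrix_inv (hk : Measurable fun p : D × D => k p.1 p.2)
    {x : Fin n → Ω → D} (hx : ∀ j, Measurable (x j)) (i j : Fin n) :
    Measurable fun ω => (kernelMatrix k (fun j => x j ω) +
      lam • (1 : Matrix (Fin n) (Fin n) ℝ))⁻¹ i j := by
  refine measurable_matrix_inv (fun i j => ?_) i j
  simp only [kernelMatrix, Matrix.add_apply, Matrix.of_apply]
  exact (measurable_kernel_comp hk (hx i) (hx j)).add_const _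

lemma measurable_posteriorMean (hk : Measurable fun p : D × D => k p.1 p.2)
    {x : Fin n → Ω → D} (hx : ∀ j, Measurable (x j))
    {y : Fin n → Ω → ℝ} (hy : ∀ j, Measurable (y j)) {p : Ω → D} (hp : Measurable p) :
    Measurable fun ω => posteriorMean k lam (fun j => x j ω) (fun j => y j ω) (p ω) :=
  measurable_dotProduct_mulVec (measurable_ridgeMatrix_inv hk hx)
    (fun i => measurable_kernel_comp hk (hx i) hp) hy

lemma measurable_posteriorVar (hk : Measurable fun p : D × D => k p.1 p.2)
    {x : Fin n → Ω → D} (hx : ∀ j, Measurable (x j)) {p : Ω → D}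
    (hp : Measurable p) : Measurable fun ω => posteriorVar k lam (fun j => x j ω) (p ω) :=
  (measurable_kernel_comp hk hp hp).sub (measurable_dotProduct_mulVec
    (measurable_ridgeMatrix_inv hk hx) (fun i => measurable_kernel_comp hk (hx i) hp)
    (fun i => measurable_kernel_comp hk (hx i) hp))

lemma measurable_ucb (hk : Measurable fun p : D × D => k p.1 p.2)
    {β : ℕ → ℝ} {t : ℕ} {x : ℕ → Ω → D} (hx : ∀ j < t, Measurable (x j))
    {y : ℕ → Ω → ℝ} (hy : ∀ j < t, Measurable (y j)) {p : Ω → D} (hp : Measurable p) :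
    Measurable fun ω => ucb k lam β (fun j => x j ω) (fun j => y j ω) t (p ω) :=
  ((measurable_posteriorMean hk (fun j => hx j j.2) (fun j => hy j j.2) hp).add
    ((measurable_posteriorVar hk (fun j => hx j j.2) hp).sqrt.const_mul _)).min measurable_const

lemma measurable_ite_eq {Z : Type*} [Finite Z] [DecidableEq Z] [MeasurableSpace Z]
    [MeasurableSingletonClass Z] {z z' : Ω → Z} (hz : Measurable z) (hz' : Measurable z')
    {f : Ω → ℝ} (hf : Measurable f) : Measurable fun ω => if z ω = z' ω then f ω else 0 :=
  Measurable.ite ((hz.prodMk hz') (Set.toFinite {q : Z × Z | q.1 = q.2}).measurableSet) hf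
    measurable_const

lemma measurable_mwStrategy {A Opp Z : Type*} [Fintype A] [MeasurableSpace A] [MeasurableSpace Opp]
    [Finite Z] [DecidableEq Z] [MeasurableSpace Z] [MeasurableSingletonClass Z]
    {k : A × Opp × Z → A × Opp × Z → ℝ}
    (hk : Measurable fun p : (A × Opp × Z) × (A × Opp × Z) => k p.1 p.2) {β : ℕ → ℝ}
    {a : ℕ → Ω → A} {o : ℕ → Ω → Opp} {z : ℕ → Ω → Z} {y : ℕ → Ω → ℝ} {t : ℕ}
    (ha : ∀ s < t, Measurable (a s)) (ho : ∀ s < t, Measurable (o s))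
    (hz : ∀ s ≤ t, Measurable (z s)) (hy : ∀ s < t, Measurable (y s)) (b : A) :
    Measurable fun ω => mwStrategy k lam β (fun s => a s ω) (fun s => o s ω) (fun s => z s ω)
      (fun s => y s ω) t b := by
  have hrate : Measurable fun ω => learningRate (Fintype.card A) (fun s => z s ω) t := by
    have h : Measurable fun ω => ∑ s ∈ range (t + 1), if z s ω = z t ω then (1 : ℝ) else 0 :=
      Finset.measurable_sum _ fun s hs => measurable_ite_eq
        (hz s (Nat.lt_succ_iff.1 (mem_range.1 hs))) (hz t le_rfl) measurable_const
    exact ((h.const_div _).sqrt).const_mul _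
  have hscore (b : A) : Measurable fun ω => contextScore k lam β (fun s => a s ω)
      (fun s => o s ω) (fun s => z s ω) (fun s => y s ω) t b :=
    Finset.measurable_sum _ fun s hs => by
      have hs' := mem_range.1 hs
      refine measurable_ite_eq (hz s hs'.le) (hz t le_rfl) ?_
      exact measurable_ucb hk (x := fun j ω => (a j ω, o j ω, z j ω))
        (fun j hj => (ha j (hj.trans hs')).prodMk
          ((ho j (hj.trans hs')).prodMk (hz j (hj.trans hs').le)))
        (fun j hj => hy j (hj.trans hs')) (p := fun ω => (b, o s ω, z s ω))
        (measurable_const.prodMk ((ho s hs').prodMk (hz s hs'.le)))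
  unfold mwStrategy
  fun_prop

/-- The elements of a reproducing kernel Hilbert space with a measurable kernel are measurable. -/
lemma measurable_rkhs {H : Type*} [NormedAddCommGroup H] [InnerProductSpace ℝ H] [CompleteSpace H]
    [RKHS ℝ H D ℝ] (hk : Measurable fun p : D × D => k p.1 p.2)
    (hkH : ∀ x y, RKHS.kernel H x y 1 = k x y) (f : H) : Measurable f := by
  have hspan : ∀ g ∈ Submodule.span ℝ {RKHS.kerFun H x v | (x : D) (v : ℝ)}, Measurable g := by
    intro g hg
    induction hg using Submodule.span_induction with
    | mem g hg =>
      obtain ⟨x, v, rfl⟩ := hg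
      have h : (RKHS.kerFun H x v : D → ℝ) = fun p => v * k p x := by
        ext p
        rw [RKHS.kerFun_apply, ← hkH, ← smul_eq_mul, ← map_smul, smul_eq_mul, mul_one]
      rw [h]
      exact (hk.comp measurable_prodMk_right).const_mul v
    | zero => rw [RKHS.coe_zero]; exact measurable_const
    | add f g _ _ hf hg => rw [RKHS.coe_add]; exact hf.add hg
    | smul c f _ hf => rw [RKHS.coe_smul]; exact hf.const_smul c
  -- Kernel sections span a dense subspace, and norm convergence implies pointwise convergence
  -- because evaluations are continuous.
  have hf : f ∈ closure
      (Submodule.span ℝ {RKHS.kerFun H x v | (x : D) (v : ℝ)} : Set H) := by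
    rw [← Submodule.topologicalClosure_coe, RKHS.kerFun_dense]
    trivial
  obtain ⟨g, hg, hlim⟩ := mem_closure_iff_seq_limit.1 hf
  refine measurable_of_tendsto_metrizable (fun n => hspan _ (hg n)) (tendsto_pi_nhds.2 fun x => ?_)
  exact ((RKHS.continuous_eval x).tendsto f).comp hlim

end Measurability

/-! ### The confidence event -/

section Confidence

open scoped ENNReal RealInnerProductSpace

/-- The likelihood ratio of the mixture, as a product over the observations. -/
lemma prod_mixture_eq {D H : Type*} [NormedAddCommGroup H] [InnerProductSpace ℝ H]
    {k : D → D → ℝ} {φ : D → H} {lam : ℝ} (hk : ∀ x y, k x y = ⟪φ x, φ y⟫) (hlam : 0 < lam)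
    (σ : ℝ) (x : ℕ → D) (e : ℕ → ℝ) (n : ℕ) :
    ∏ t ∈ range n, Real.exp ((posteriorVar k lam (fun j : Fin t => x j) (x t) / lam * e t ^ 2
        + 2 * posteriorMean k lam (fun j : Fin t => x j) (fun j => e j) (x t) * e t
        - posteriorMean k lam (fun j : Fin t => x j) (fun j => e j) (x t) ^ 2) /
        (1 + posteriorVar k lam (fun j : Fin t => x j) (x t) / lam) / (2 * σ ^ 2)) /
        √(1 + posteriorVar k lam (fun j : Fin t => x j) (x t) / lam) =
      Real.exp (noiseEnergy k lam (fun j : Fin n => x j) (fun j => e j) / (2 * σ ^ 2)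
        - infoGain k lam (fun j : Fin n => x j)) := by
  induction n with
  | zero => simp [noiseEnergy, infoGain_zero]
  | succ n ih =>
    rw [Finset.prod_range_succ, ih, noiseEnergy_succ hk hlam, infoGain_succ hk hlam]
    set s := posteriorVar k lam (fun j : Fin n => x j) (x n) / lam with hs
    have hs0 : 0 ≤ s := div_nonneg (posteriorVar_nonneg hk hlam _ _) hlam.le
    have h1 : √(1 + s) = Real.exp (1 / 2 * Real.log (1 + s)) := by
      rw [Real.sqrt_eq_rpow, Real.rpow_def_of_pos (by linarith), mul_comm]
    rw [h1, ← Real.exp_sub, ← Real.exp_add, add_div]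
    congr 1
    ring

/-- The self-normalized concentration inequality for the noise, uniformly over time. -/
lemma measureReal_noiseEnergy_gt_le {Ω D H : Type*} {mΩ : MeasurableSpace Ω} {P : Measure Ω}
    [IsProbabilityMeasure P] [MeasurableSpace D] [NormedAddCommGroup H] [InnerProductSpace ℝ H]
    {k : D → D → ℝ} {φ : D → H} {lam : ℝ} (hk : ∀ x y, k x y = ⟪φ x, φ y⟫)
    (hkm : Measurable fun p : D × D => k p.1 p.2) (hlam : 0 < lam) {σ : ℝ≥0} {T : ℕ}
    {G : ℕ → MeasurableSpace Ω} (hG : ∀ t < T, G t ≤ mΩ) {x : ℕ → Ω → D} {ε : ℕ → Ω → ℝ}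
    (hx : ∀ t < T, ∀ s ≤ t, Measurable[G t] (x s)) (hεG : ∀ t < T, ∀ s < t, Measurable[G t] (ε s))
    (hε : ∀ t < T, Measurable (ε t)) (hsub : ∀ t < T, HasSubgaussianMGF (ε t) (σ ^ 2) P)
    (hindep : ∀ t < T, Indep (MeasurableSpace.comap (ε t) inferInstance) (G t) P)
    {δ : ℝ} (hδ : 0 < δ) :
    P.real {ω | ∃ t < T, 2 * (σ : ℝ) ^ 2 *
      (infoGain k lam (fun j : Fin t => x j ω) + Real.log (1 / δ)) <
        noiseEnergy k lam (fun j : Fin t => x j ω) (fun j => ε j ω)} ≤ δ := by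
  -- The mixture divides by `σ ^ 2`; for `σ = 0` the noise vanishes almost surely and so does its
  -- energy.
  rcases eq_zero_or_pos σ with rfl | hσ
  · refine le_of_eq_of_le ?_ hδ.le
    rw [measureReal_eq_zero_iff]
    have h0 : ∀ᵐ ω ∂P, ∀ t < T, ε t ω = 0 := by
      rw [ae_all_iff]
      intro t
      by_cases ht : t < T
      · have := hsub t ht
        simp only [ne_eq, OfNat.ofNat_ne_zero, not_false_eq_true, zero_pow] at this
        filter_upwards [this.ae_eq_zero_of_hasSubgaussianMGF_zero] with ω hω _ using hω
      · simp [ht]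
    refine measure_mono_null ?_ (ae_iff.1 h0)
    rintro ω ⟨t, ht, hlt⟩ h
    have h1 : (fun j : Fin t => ε j ω) = 0 := funext fun j => h j (j.2.trans ht)
    rw [h1] at hlt
    simp [noiseEnergy] at hlt
  · set s : ℕ → Ω → ℝ := fun t ω => posteriorVar k lam (fun j : Fin t => x j ω) (x t ω) / lam
      with hs
    set μ : ℕ → Ω → ℝ := fun t ω =>
      posteriorMean k lam (fun j : Fin t => x j ω) (fun j => ε j ω) (x t ω) with hμ
    have hs0 : ∀ t ω, 0 ≤ s t ω := fun t ω =>
      div_nonneg (posteriorVar_nonneg hk hlam _ _) hlam.le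
    have hsm : ∀ t < T, ∀ r ≤ t, Measurable[G t] (s r) := fun t ht r hr => by
      have h1 := fun s hs => hx t ht s hs
      let _ := G t
      exact (measurable_posteriorVar hkm (x := fun (j : Fin r) ω => x j ω)
        (fun j => h1 j (j.2.le.trans hr)) (h1 r hr)).div_const _
    have hμm : ∀ t < T, ∀ r ≤ t, Measurable[G t] (μ r) := fun t ht r hr => by
      have h1 := fun s hs => hx t ht s hs
      have h2 := fun s hs => hεG t ht s hs
      let _ := G t
      exact measurable_posteriorMean hkm (x := fun (j : Fin r) ω => x j ω)
        (y := fun (j : Fin r) ω => ε j ω) (fun j => h1 j (j.2.le.trans hr))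
        (fun j => h2 j (j.2.trans_le hr)) (h1 r hr)
    set Y : ℕ → Ω → ℝ := fun t ω =>
      Real.exp ((s t ω * ε t ω ^ 2 + 2 * μ t ω * ε t ω - μ t ω ^ 2) / (1 + s t ω) /
        (2 * (σ : ℝ) ^ 2)) / √(1 + s t ω) with hY
    have hY0 : ∀ t ω, 0 ≤ Y t ω := fun t ω => by positivity
    set M : ℕ → Ω → ℝ≥0∞ := fun t ω => ENNReal.ofReal (∏ r ∈ range t, Y r ω) with hM
    have hMm : ∀ t < T, ∀ r ≤ t, Measurable[G t] (M r) := fun t ht r hr => by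
      have h : Measurable[G t] fun ω => ∏ q ∈ range r, Y q ω := by
        refine Finset.measurable_prod _ fun q hq => ?_
        have hqt : q < t := (mem_range.1 hq).trans_le hr
        have h1 := hsm t ht q hqt.le
        have h2 := hμm t ht q hqt.le
        have h3 := hεG t ht q hqt
        let _ := G t
        simp only [hY]
        fun_prop
      exact h.ennreal_ofReal
    have key := mul_measure_exists_le_le_one hG (P := P) (Y := fun t ω => ENNReal.ofReal (Y t ω))
      hMm (by simp [hM]) (fun t ht N hN => lintegral_mul_mixture_le (hG t ht) (hε t ht)
        (hindep t ht) hσ (hsub t ht) hN (hsm t ht t le_rfl) (hμm t ht t le_rfl) (hs0 t))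
      (fun t _ ω => by
        simp only [hM]
        rw [Finset.prod_range_succ, ENNReal.ofReal_mul (Finset.prod_nonneg fun r _ => hY0 r ω)])
      (ENNReal.ofReal (1 / δ))
    have hsubset : {ω | ∃ t < T, 2 * (σ : ℝ) ^ 2 *
        (infoGain k lam (fun j : Fin t => x j ω) + Real.log (1 / δ)) <
          noiseEnergy k lam (fun j : Fin t => x j ω) (fun j => ε j ω)} ⊆
        {ω | ∃ t < T, ENNReal.ofReal (1 / δ) ≤ M t ω} := by
      rintro ω ⟨t, ht, hlt⟩
      refine ⟨t, ht, ENNReal.ofReal_le_ofReal ?_⟩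
      have hσ' : (0 : ℝ) < σ := by exact_mod_cast hσ
      have h := prod_mixture_eq hk hlam σ (fun j => x j ω) (fun j => ε j ω) t
      refine le_of_le_of_eq ?_ h.symm
      rw [← Real.log_le_iff_le_exp (by positivity), le_sub_iff_add_le', le_div_iff₀ (by positivity)]
      linarith
    have hfin := (mul_le_mul_right (measure_mono hsubset) _).trans key
    have hinv : ENNReal.ofReal (1 / δ) = (ENNReal.ofReal δ)⁻¹ := by
      rw [one_div, ENNReal.ofReal_inv_of_pos hδ]
    rw [hinv, ENNReal.inv_mul_le_iff (by simpa using hδ)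
      ENNReal.ofReal_ne_top, mul_one] at hfin
    exact ENNReal.toReal_le_of_le_ofReal hδ.le hfin

end Confidence

/-! ### The regret bound -/

section Regret

open scoped RealInnerProductSpace

section Confidence

variable {D H : Type*} [NormedAddCommGroup H] [InnerProductSpace ℝ H]
  {k : D → D → ℝ} {φ : D → H} {lam δ B : ℝ} {σ : ℝ≥0}

lemma confidenceLevel_mono [Nonempty D] (hk : ∀ x y, k x y = ⟪φ x, φ y⟫) (hlam : 1 ≤ lam)
    (hbdd : ∀ x y, |k x y| ≤ 1) : Monotone (confidenceLevel k lam σ B δ) := fun s t hst => by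
  have h := maxInfoGain_mono hk hlam hbdd (Nat.sub_le_sub_right hst 1)
  have hl : 0 ≤ lam ^ (-(1 / 2) : ℝ) := Real.rpow_nonneg (by linarith) _
  unfold confidenceLevel
  gcongr

lemma confidenceLevel_nonneg (hlam : 1 ≤ lam) (hB : 0 ≤ B) (t : ℕ) :
    0 ≤ confidenceLevel k lam σ B δ t := by
  have hl : 0 ≤ lam ^ (-(1 / 2) : ℝ) := Real.rpow_nonneg (by linarith) _
  unfold confidenceLevel
  positivity

/-- Passes from the realized information gain to the maximal one. Index `t` is round `t + 1`, whose
confidence level involves the gain from `t` observations. -/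
lemma abs_posteriorMean_sub_le_confidenceLevel (hk : ∀ x y, k x y = ⟪φ x, φ y⟫) (hlam : 1 ≤ lam)
    (hbdd : ∀ x y, |k x y| ≤ 1) {f : H} (hB : ‖f‖ ≤ B) (x : ℕ → D) (e : ℕ → ℝ) {t : ℕ}
    (he : noiseEnergy k lam (fun j : Fin t => x j) (fun j => e j) ≤
      2 * (σ : ℝ) ^ 2 * (infoGain k lam (fun j : Fin t => x j) + Real.log (2 / δ))) (p : D) :
    |posteriorMean k lam (fun j : Fin t => x j) (fun j => ⟪f, φ (x j)⟫ + e j) p - ⟪f, φ p⟫| ≤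
      confidenceLevel k lam σ B δ (t + 1) * √(posteriorVar k lam (fun j : Fin t => x j) p) := by
  have hl : 0 < lam := by linarith
  refine (abs_posteriorMean_sub_le hk hl _ _ f p).trans ?_
  refine mul_le_mul_of_nonneg_right (add_le_add hB ?_) (Real.sqrt_nonneg _)
  have h1 : (σ : ℝ) * lam ^ (-(1 / 2) : ℝ) *
      √(2 * (maxInfoGain k lam t + Real.log (2 / δ))) =
      √((σ : ℝ) ^ 2 * lam⁻¹ * (2 * (maxInfoGain k lam t + Real.log (2 / δ)))) := by
    rw [Real.sqrt_mul (mul_nonneg (sq_nonneg _) (inv_nonneg.2 hl.le)),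
      Real.sqrt_mul (sq_nonneg _), Real.sqrt_sq (NNReal.coe_nonneg σ),
      Real.rpow_neg hl.le, Real.sqrt_inv, Real.sqrt_eq_rpow lam]
  rw [Nat.add_sub_cancel, h1]
  apply Real.sqrt_le_sqrt
  have h2 := infoGain_le_maxInfoGain hk hlam hbdd (fun j : Fin t => x j)
  calc noiseEnergy k lam (fun j : Fin t => x j) (fun j => e j) / lam
      ≤ 2 * (σ : ℝ) ^ 2 * (maxInfoGain k lam t + Real.log (2 / δ)) / lam := by
        refine div_le_div_of_nonneg_right (he.trans ?_) hl.le
        gcongr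
    _ = _ := by rw [div_eq_mul_inv]; ring

end Confidence

variable {A Opp Z : Type*} {k : A × Opp × Z → A × Opp × Z → ℝ} {lam : ℝ}

/-- The upper confidence bounds of all actions, clipped to `[0, 1]`. -/
noncomputable def clippedUcb (k : A × Opp × Z → A × Opp × Z → ℝ) (lam : ℝ) (β : ℕ → ℝ)
    (a : ℕ → A) (o : ℕ → Opp) (z : ℕ → Z) (y : ℕ → ℝ) (t : ℕ) (b : A) : ℝ :=
  max (ucb k lam β (fun j => (a j, o j, z j)) y t (b, o t, z t)) 0

lemma clippedUcb_mem (β : ℕ → ℝ) (a : ℕ → A) (o : ℕ → Opp) (z : ℕ → Z) (y : ℕ → ℝ) (t : ℕ)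
    (b : A) : clippedUcb k lam β a o z y t b ∈ Set.Icc (0 : ℝ) 1 :=
  ⟨le_max_right _ _, max_le (min_le_right _ _) zero_le_one⟩

lemma mwStrategy_eq [Fintype A] [DecidableEq Z] (β : ℕ → ℝ) (a : ℕ → A) (o : ℕ → Opp) (z : ℕ → Z) (y : ℕ → ℝ) (t : ℕ) :
    mwStrategy k lam β a o z y t = mwWeights
      (fun s b => ucb k lam β (fun j => (a j, o j, z j)) y s (b, o s, z s)) z t := rfl

/-- The regret bound on the event on which the noise and the sampling are well concentrated. -/
lemma contextualRegret_le [Fintype A] [Nonempty A] [Fintype Z] [DecidableEq Z] {H : Type*}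
    [NormedAddCommGroup H] [InnerProductSpace ℝ H] {φ : A × Opp × Z → H} {δ B : ℝ} {σ : ℝ≥0}
    (hk : ∀ x y, k x y = ⟪φ x, φ y⟫) (hlam : 1 ≤ lam)
    (hbdd : ∀ x y, |k x y| ≤ 1) {f : H} (hB : ‖f‖ ≤ B)
    (hf : ∀ p, ⟪f, φ p⟫ ∈ Set.Icc (0 : ℝ) 1) {T : ℕ}
    (a : ℕ → A) (o : ℕ → Opp) (z : ℕ → Z) (e : ℕ → ℝ) {y : ℕ → ℝ}
    (hy : y = fun s => ⟪f, φ (a s, o s, z s)⟫ + e s)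
    (henergy : ∀ t < T, noiseEnergy k lam (fun j : Fin t => (a j, o j, z j)) (fun j => e j) ≤
      2 * (σ : ℝ) ^ 2 *
        (infoGain k lam (fun j : Fin t => (a j, o j, z j)) + Real.log (2 / δ)))
    {S : ℝ} (hS : ∑ t ∈ range T,
      (∑ b, mwStrategy k lam (confidenceLevel k lam σ B δ) a o z y t b *
        clippedUcb k lam (confidenceLevel k lam σ B δ) a o z y t b -
        clippedUcb k lam (confidenceLevel k lam σ B δ) a o z y t (a t)) ≤ S) :
    contextualRegret (fun p => ⟪f, φ p⟫) a o z T ≤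
      √(T * Fintype.card Z * Real.log (Fintype.card A)) + S +
        4 * confidenceLevel k lam σ B δ T * √(maxInfoGain k lam T * lam * T) := by
  set β := confidenceLevel k lam σ B δ with hβ
  set x : ℕ → A × Opp × Z := fun j => (a j, o j, z j) with hx
  have hl : 0 < lam := by linarith
  have : Nonempty (A × Opp × Z) := ⟨x 0⟩
  have hconf : ∀ t < T, ∀ p, |posteriorMean k lam (fun j : Fin t => x j) (fun j => y j) p
      - ⟪f, φ p⟫| ≤ β (t + 1) * √(posteriorVar k lam (fun j : Fin t => x j) p) :=
    fun t ht p => by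
      rw [hy]
      exact abs_posteriorMean_sub_le_confidenceLevel hk hlam hbdd hB x e (henergy t ht) p
  have hle : ∀ t < T, ∀ p, ⟪f, φ p⟫ ≤ ucb k lam β x y t p := fun t ht p => by
    have h := abs_le.1 (hconf t ht p)
    exact le_min (by linarith [h.1]) (hf p).2
  have hclip : ∀ t < T, ∀ b, clippedUcb k lam β a o z y t b =
      ucb k lam β x y t (b, o t, z t) := fun t ht b =>
    max_eq_left ((hf _).1.trans (hle t ht _))
  -- The strategy is driven by unclipped bounds, but on this event all past ones agree with the
  -- clipped ones, to which the regret bound applies.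
  have hstrat : ∀ t < T, mwStrategy k lam β a o z y t =
      mwWeights (clippedUcb k lam β a o z y) z t := fun t ht => by
    rw [mwStrategy_eq, mwWeights, mwWeights]
    congr 1
    ext b
    refine Finset.sum_congr rfl fun s hs => ?_
    rw [hclip s ((mem_range.1 hs).trans ht)]
  have hgap : ∀ t ∈ range T, clippedUcb k lam β a o z y t (a t) - ⟪f, φ (x t)⟫ ≤
      2 * β T * √(posteriorVar k lam (fun j : Fin t => x j) (x t)) := fun t ht => by
    have ht' := mem_range.1 ht
    rw [hclip t ht']
    have h := abs_le.1 (hconf t ht' (x t))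
    have h1 : ucb k lam β x y t (x t) ≤ _ := min_le_left _ _
    have h2 : β (t + 1) * √(posteriorVar k lam (fun j : Fin t => x j) (x t)) ≤
        β T * √(posteriorVar k lam (fun j : Fin t => x j) (x t)) :=
      mul_le_mul_of_nonneg_right (confidenceLevel_mono hk hlam hbdd ht') (Real.sqrt_nonneg _)
    change ucb k lam β x y t (x t) - _ ≤ _
    linarith [h.2]
  have hsum : ∑ t ∈ range T, (clippedUcb k lam β a o z y t (a t) - ⟪f, φ (x t)⟫) ≤
      4 * β T * √(maxInfoGain k lam T * lam * T) := by
    refine (Finset.sum_le_sum hgap).trans ?_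
    rw [← Finset.mul_sum]
    have h0 : 0 ≤ β T := confidenceLevel_nonneg hlam ((norm_nonneg f).trans hB) T
    have h1 : ∑ t ∈ range T, √(posteriorVar k lam (fun j : Fin t => x j) (x t)) ≤
        2 * √(maxInfoGain k lam T * lam * T) := by
      have h2 : (2 : ℝ) * √(maxInfoGain k lam T * lam * T) =
          √(2 ^ 2 * (maxInfoGain k lam T * lam * T)) := by
        rw [Real.sqrt_mul (sq_nonneg 2), Real.sqrt_sq zero_le_two]
      rw [h2]
      apply Real.le_sqrt_of_sq_le
      -- Cauchy–Schwarz over rounds turns the sum of standard deviations into one of variances.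
      refine sq_sum_le_card_mul_sum_sq.trans ?_
      simp_rw [Real.sq_sqrt (posteriorVar_nonneg hk hl _ _)]
      rw [card_range]
      have h3 := sum_posteriorVar_le hk hlam hbdd x T
      have h4 := infoGain_le_maxInfoGain hk hlam hbdd (fun j : Fin T => x j)
      calc (T : ℝ) * _ ≤ T * (4 * (lam * maxInfoGain k lam T)) := by
            gcongr
            exact h3.trans (by gcongr)
        _ = _ := by ring
    calc _ ≤ 2 * β T * (2 * √(maxInfoGain k lam T * lam * T)) := by gcongr
      _ = _ := by ring
  have hbest : (⨆ π : Z → A, ∑ t ∈ range T, ⟪f, φ (π (z t), o t, z t)⟫) ≤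
      √(T * Fintype.card Z * Real.log (Fintype.card A)) +
        ∑ t ∈ range T, ∑ b, mwStrategy k lam β a o z y t b * clippedUcb k lam β a o z y t b := by
    refine ciSup_le fun π => ?_
    have h1 := mw_regret_le (u := clippedUcb k lam β a o z y) (z := z) (T := T)
      (fun t _ b => clippedUcb_mem β a o z y t b) π
    have h2 : ∑ t ∈ range T, ⟪f, φ (π (z t), o t, z t)⟫ ≤
        ∑ t ∈ range T, clippedUcb k lam β a o z y t (π (z t)) :=
      Finset.sum_le_sum fun t ht => by
        rw [hclip t (mem_range.1 ht)]
        exact hle t (mem_range.1 ht) _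
    have h3 : ∑ t ∈ range T, ∑ b, mwStrategy k lam β a o z y t b * clippedUcb k lam β a o z y t b =
        ∑ t ∈ range T, ∑ b, mwWeights (clippedUcb k lam β a o z y) z t b *
          clippedUcb k lam β a o z y t b :=
      Finset.sum_congr rfl fun t ht => by rw [hstrat t (mem_range.1 ht)]
    rw [h3]
    linarith
  rw [Finset.sum_sub_distrib] at hS hsum
  unfold contextualRegret
  linarith

end Regret

/-! ### Measurability with respect to the history -/

section History

variable {Ω A Opp Z : Type*} [MeasurableSpace A] [MeasurableSpace Opp]
  [MeasurableSpace Z] {a : ℕ → Ω → A} {o : ℕ → Ω → Opp} {z : ℕ → Ω → Z} {ε : ℕ → Ω → ℝ}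

lemma measurable_history {s t : ℕ} (h : s < t) :
    Measurable[history a o z ε t] fun ω => (a s ω, o s ω, z s ω, ε s ω) :=
  Measurable.mono (comap_measurable _)
    (le_iSup (fun s : Fin t => MeasurableSpace.comap
      (fun ω => (a s ω, o s ω, z s ω, ε s ω)) inferInstance) ⟨s, h⟩) le_rfl

lemma history_le [mΩ : MeasurableSpace Ω] {t : ℕ} (ha : ∀ s < t, Measurable (a s)) (ho : ∀ s < t, Measurable (o s))
    (hz : ∀ s < t, Measurable (z s)) (hε : ∀ s < t, Measurable (ε s)) :
    history a o z ε t ≤ mΩ :=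
  iSup_le fun s => ((ha s s.2).prodMk
    ((ho s s.2).prodMk ((hz s s.2).prodMk (hε s s.2)))).comap_le

end History

end ContextualGame

/-! ### The main theorem -/

open ContextualGame in
theorem theorem3
    {A Opp Z : Type*} [Fintype A] [Nonempty A] [MeasurableSpace A] [MeasurableSingletonClass A]
    [MeasurableSpace Opp]
    [Fintype Z] [DecidableEq Z] [MeasurableSpace Z] [MeasurableSingletonClass Z]
    -- the kernel, with values in `[-1, 1]`, and its reproducing kernel Hilbert space `H`
    (k : A × Opp × Z → A × Opp × Z → ℝ)
    (hk_meas : Measurable fun p : (A × Opp × Z) × (A × Opp × Z) => k p.1 p.2)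
    (hk_bdd : ∀ x y, |k x y| ≤ 1)
    {H : Type*} [NormedAddCommGroup H] [InnerProductSpace ℝ H] [CompleteSpace H]
    [RKHS ℝ H (A × Opp × Z) ℝ]
    (hk : ∀ x y, RKHS.kernel H x y 1 = k x y)
    -- the reward function
    (r : H) (hr : ∀ x, r x ∈ Set.Icc (0 : ℝ) 1)
    (B : ℝ) (hB : ‖r‖ ≤ B)
    -- the parameters
    (δ : ℝ) (hδ : δ ∈ Set.Ioo (0 : ℝ) 1) (lam : ℝ) (hlam : 1 ≤ lam) (σ : ℝ≥0) (T : ℕ)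
    -- the play
    {Ω : Type*} [MeasurableSpace Ω] (P : Measure Ω) [IsProbabilityMeasure P]
    (a : ℕ → Ω → A) (o : ℕ → Ω → Opp) (z : ℕ → Ω → Z) (ε : ℕ → Ω → ℝ)
    (hplay : ContextualGame.IsRepeatedPlay P T (fun x => r x) σ
      (ContextualGame.mwStrategy k lam (ContextualGame.confidenceLevel k lam σ B δ)) a o z ε) :
    1 - δ ≤ P.real {ω |
      ContextualGame.contextualRegret (fun x => r x)
          (fun t => a t ω) (fun t => o t ω) (fun t => z t ω) T
        ≤ √(T * Fintype.card Z * Real.log (Fintype.card A))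
          + √(0.5 * T * Real.log (2 / δ))
          + 4 * ContextualGame.confidenceLevel k lam σ B δ T
            * √(ContextualGame.maxInfoGain k lam T * lam * T)} := by
  -- The failure probability is shared equally by the noise and the sampling, whence `log (2 / δ)`.
  have hδ2 : 0 < δ / 2 := half_pos hδ.1
  have hlog : 1 / (δ / 2) = 2 / δ := one_div_div δ 2
  set φ : A × Opp × Z → H := fun p => RKHS.kerFun H p 1 with hφ
  have hkφ : ∀ p q, k p q = inner ℝ (φ p) (φ q) := fun p q => by
    rw [hφ, RKHS.kerFun_inner, RKHS.kerFun_apply, hk]; simp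
  have hrφ : ∀ p, r p = inner ℝ r (φ p) := fun p => by simp [hφ]
  have hrm : Measurable r := measurable_rkhs hk_meas hk r
  set β := confidenceLevel k lam σ B δ with hβ
  set y : ℕ → Ω → ℝ := fun s ω => r (a s ω, o s ω, z s ω) + ε s ω with hy
  have hhist : ∀ t < T, history a o z ε t ≤ ‹MeasurableSpace Ω› := fun t ht =>
    history_le (fun s hs => hplay.measurable_action s (hs.trans ht))
      (fun s hs => hplay.measurable_opponents s (hs.trans ht))
      (fun s hs => hplay.measurable_context s (hs.trans ht))
      (fun s hs => hplay.measurable_noise s (hs.trans ht))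
  -- concentration of the noise
  have hnoise := measureReal_noiseEnergy_gt_le (P := P) hkφ hk_meas (zero_lt_one.trans_le hlam) (σ := σ) (T := T)
    -- Noise is realized after the moves, so this σ-algebra contains the current action.
    (G := fun t => history a o z ε t ⊔
      MeasurableSpace.comap (fun ω => (a t ω, o t ω, z t ω)) inferInstance)
    (x := fun t ω => (a t ω, o t ω, z t ω)) (ε := ε)
    (fun t ht => sup_le (hhist t ht) ((hplay.measurable_action t ht).prodMk
      ((hplay.measurable_opponents t ht).prodMk (hplay.measurable_context t ht))).comap_le)
    (fun t _ s hs => by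
      rcases hs.eq_or_lt with rfl | hs
      · exact (comap_measurable _).mono le_sup_right le_rfl
      · have h := (measurable_history (a := a) (o := o) (z := z) (ε := ε) hs).mono
          (le_sup_left (b := MeasurableSpace.comap (fun ω => (a t ω, o t ω, z t ω)) inferInstance))
          le_rfl
        exact h.fst.prodMk (h.snd.fst.prodMk h.snd.snd.fst))
    (fun t _ s hs => (measurable_history hs).snd.snd.snd.mono le_sup_left le_rfl)
    hplay.measurable_noise hplay.noise_subgaussian hplay.noise_indep hδ2
  -- concentration of the sampled actions
  have hGm : ∀ t, (∀ s < t, Measurable[history a o z ε t ⊔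
        MeasurableSpace.comap (fun ω => (o t ω, z t ω)) inferInstance] (a s)) ∧
      (∀ s ≤ t, Measurable[history a o z ε t ⊔
        MeasurableSpace.comap (fun ω => (o t ω, z t ω)) inferInstance] (o s)) ∧
      (∀ s ≤ t, Measurable[history a o z ε t ⊔
        MeasurableSpace.comap (fun ω => (o t ω, z t ω)) inferInstance] (z s)) ∧
      (∀ s < t, Measurable[history a o z ε t ⊔
        MeasurableSpace.comap (fun ω => (o t ω, z t ω)) inferInstance] (y s)) := fun t => by
    have h : ∀ s < t, Measurable[history a o z ε t ⊔
        MeasurableSpace.comap (fun ω => (o t ω, z t ω)) inferInstance]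
          fun ω => (a s ω, o s ω, z s ω, ε s ω) := fun s hs =>
      (measurable_history hs).mono le_sup_left le_rfl
    have h' : Measurable[history a o z ε t ⊔
        MeasurableSpace.comap (fun ω => (o t ω, z t ω)) inferInstance]
          fun ω => (o t ω, z t ω) := (comap_measurable _).mono le_sup_right le_rfl
    refine ⟨fun s hs => (h s hs).fst, fun s hs => ?_, fun s hs => ?_, fun s hs => ?_⟩
    · rcases hs.eq_or_lt with rfl | hs
      · exact h'.fst
      · exact (h s hs).snd.fst
    · rcases hs.eq_or_lt with rfl | hs
      · exact h'.snd
      · exact (h s hs).snd.snd.fst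
    · exact (hrm.comp ((h s hs).fst.prodMk ((h s hs).snd.fst.prodMk (h s hs).snd.snd.fst))).add
        (h s hs).snd.snd.snd
  have haction := measureReal_sum_gt_le (P := P) (T := T)
    -- Here the current action is left out, as it is the variable being sampled.
    (G := fun t => history a o z ε t ⊔
      MeasurableSpace.comap (fun ω => (o t ω, z t ω)) inferInstance) (a := a)
    (p := fun t b ω => mwStrategy k lam β (fun s => a s ω) (fun s => o s ω) (fun s => z s ω)
      (fun s => y s ω) t b)
    (u := fun t b ω => clippedUcb k lam β (fun s => a s ω) (fun s => o s ω) (fun s => z s ω)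
      (fun s => y s ω) t b)
    (fun t ht => sup_le (hhist t ht) ((hplay.measurable_opponents t ht).prodMk
      (hplay.measurable_context t ht)).comap_le)
    hplay.measurable_action
    (fun t _ s hs b => by
      obtain ⟨ha, ho, hz, hy⟩ := hGm t
      let _ := history a o z ε t ⊔
        MeasurableSpace.comap (fun ω => (o t ω, z t ω)) inferInstance
      exact measurable_mwStrategy hk_meas (fun j hj => ha j (hj.trans_le hs))
        (fun j hj => ho j (hj.le.trans hs)) (fun j hj => hz j (hj.trans hs))
        (fun j hj => hy j (hj.trans_le hs)) b)
    (fun t _ s hs b => by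
      obtain ⟨ha, ho, hz, hy⟩ := hGm t
      let _ := history a o z ε t ⊔
        MeasurableSpace.comap (fun ω => (o t ω, z t ω)) inferInstance
      exact (measurable_ucb hk_meas (x := fun j ω => (a j ω, o j ω, z j ω))
        (fun j hj => (ha j (hj.trans_le hs)).prodMk
          ((ho j (hj.le.trans hs)).prodMk (hz j (hj.le.trans hs))))
        (fun j hj => hy j (hj.trans_le hs))
        (measurable_const.prodMk ((ho s hs).prodMk (hz s hs)))).max measurable_const)
    (fun t _ s hs => by
      obtain ⟨ha, ho, hz, hy⟩ := hGm t
      let _ := history a o z ε t ⊔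
        MeasurableSpace.comap (fun ω => (o t ω, z t ω)) inferInstance
      exact (measurable_ucb hk_meas (x := fun j ω => (a j ω, o j ω, z j ω))
        (fun j hj => (ha j (hj.trans hs)).prodMk
          ((ho j (hj.trans hs).le).prodMk (hz j (hj.trans hs).le)))
        (fun j hj => hy j (hj.trans hs))
        ((ha s hs).prodMk ((ho s hs.le).prodMk (hz s hs.le)))).max measurable_const)
    (fun t b ω => expWeights_nonneg _ _ _) (fun t ω => sum_expWeights _ _)
    (fun t b ω => clippedUcb_mem _ _ _ _ _ _ _) hplay.action_sampled hδ2
    (by linarith [hδ.2])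
  rw [hlog] at hnoise haction
  -- the regret bound holds outside of the two bad events
  set good := {ω | contextualRegret (fun x => r x)
          (fun t => a t ω) (fun t => o t ω) (fun t => z t ω) T
        ≤ √(T * Fintype.card Z * Real.log (Fintype.card A))
          + √(0.5 * T * Real.log (2 / δ))
          + 4 * β T * √(maxInfoGain k lam T * lam * T)} with hgood
  set bad₁ := {ω | ∃ t < T, 2 * (σ : ℝ) ^ 2 *
      (infoGain k lam (fun j : Fin t => (a j ω, o j ω, z j ω)) + Real.log (2 / δ)) <
        noiseEnergy k lam (fun j : Fin t => (a j ω, o j ω, z j ω)) (fun j => ε j ω)} with hbad₁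
  set bad₂ := {ω | √(0.5 * T * Real.log (2 / δ)) < ∑ t ∈ range T,
      (∑ b, mwStrategy k lam β (fun s => a s ω) (fun s => o s ω) (fun s => z s ω)
          (fun s => y s ω) t b *
        clippedUcb k lam β (fun s => a s ω) (fun s => o s ω) (fun s => z s ω)
          (fun s => y s ω) t b -
        clippedUcb k lam β (fun s => a s ω) (fun s => o s ω) (fun s => z s ω)
          (fun s => y s ω) t (a t ω))} with hbad₂
  -- Only monotonicity and subadditivity of the measure are used afterwards, so these events need
  -- not be shown measurable.
  have hcover : Set.univ ⊆ good ∪ (bad₁ ∪ bad₂) := fun ω _ => by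
    by_cases h1 : ω ∈ bad₁
    · exact Or.inr (Or.inl h1)
    by_cases h2 : ω ∈ bad₂
    · exact Or.inr (Or.inr h2)
    refine Or.inl ?_
    simp only [hbad₁, Set.mem_ofPred_eq, not_exists, not_and, not_lt] at h1
    simp only [hbad₂, Set.mem_ofPred_eq, not_lt] at h2
    have h := contextualRegret_le (f := r) hkφ hlam hk_bdd hB (fun p => by rw [← hrφ]; exact hr p)
      (fun t => a t ω) (fun t => o t ω) (fun t => z t ω) (fun t => ε t ω)
      (y := fun t => y t ω) (by simp only [hy, ← hrφ]) h1 h2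
    simp only [← hrφ] at h
    exact h
  have h1 : (1 : ℝ) ≤ P.real good + (P.real bad₁ + P.real bad₂) := by
    calc (1 : ℝ) = P.real Set.univ := by simp
      _ ≤ P.real (good ∪ (bad₁ ∪ bad₂)) := measureReal_mono hcover
      _ ≤ P.real good + P.real (bad₁ ∪ bad₂) := measureReal_union_le _ _
      _ ≤ _ := by gcongr; exact measureReal_union_le _ _
  linarith
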